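/- There is a universal constant $c>0$ with the following property. For all $\theta\in\mathbb R$ and $z\in\mathbb C$ with $\operatorname{Im} z\ne 0$ there is $C>0$, depending only on $z$ and $\theta$, and for every real random variable $\xi$ with $\mathbb E\,\xi=\theta$ and $\operatorname{Var}\xi=1$ there are $C',\eta_0>0$, depending only on $z$ and the distribution of $\xi$, such that the following holds. Let $p_n\in[0,1]$ satisfy $p_n n\le n^{1/8}$ for all $n\ge 1$ and $\lim_{n\to\infty}p_n n=\infty$. For each $n\geq 1$ let $A_n=(\delta_{ij}\xi_{ij})$ be an $n\times n$ random matrix, where the $\delta_{ij}$ are Bernoulli ($0/1$) variables with $\mathbb P\{\delta_{ij}=1\}=p_n$, the $\xi_{ij}$ are distributed as $\xi$, and all the $\delta_{ij}$ and $\xi_{ij}$ are mutually independent. Let $$\nu_{n,z}=\frac1n\sum_{i=1}^n\delta_{s_i}$$ be the empirical measure of the singular values $s_1,\dots,s_n$ (with multiplicity) of $\frac{1}{\sqrt{p_n n}}A_n-z\,\mathrm{Id}_n$. Then, for every $n\ge1$ with $p_n>0$, $$\mathbb E\,\nu_{n,z}([0,\eta])\le C'\,\eta\quad\text{for all }\eta\ge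 (p_n n)^{-c},$$ and moreover $$\mathbb E\,\nu_{n,z}([0,\eta])\le C\,\eta\quad\text{for all }\eta\ge (p_n n)^{-c}\text{ with }\eta\le\eta_0 .$$ -/

import Mathlib

open MeasureTheory ProbabilityTheory Filter
open scoped ENNReal unitInterval

noncomputable section

/-- The empirical measure of the `n` singular values (with multiplicity) of an `n × n` complex
matrix `B`, that is `(1 / n) ∑ δ_{s_i(B)}`. The first `n` terms of the sequence
`LinearMap.singularValues` are the `n` singular values of `B`. -/
def empiricalSingularMeasure {n : ℕ} (B : Matrix (Fin n) (Fin n) ℂ) : Measure ℝ :=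
  (n : ℝ≥0∞)⁻¹ •
    ∑ i : Fin n, Measure.dirac ((Matrix.toEuclideanLin B).singularValues (i : ℕ))

/-- The matrix `(1 / √(p n)) A - z Id`. -/
def scaledShift {n : ℕ} (p : ℝ) (A : Matrix (Fin n) (Fin n) ℝ) (z : ℂ) :
    Matrix (Fin n) (Fin n) ℂ :=
  ((1 / Real.sqrt (p * n) : ℝ) : ℂ) • A.map Complex.ofReal - z • (1 : Matrix (Fin n) (Fin n) ℂ)

/-- The matrix with entries `a_ij = δ_ij ξ_ij`. -/
def sparseMatrix {n : ℕ} {Ω : Type*} (δ ξ : Fin n → Fin n → Ω → ℝ) (ω : Ω) :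
    Matrix (Fin n) (Fin n) ℝ :=
  Matrix.of fun i j => δ i j ω * ξ i j ω

/-- The `δ_ij` are Bernoulli (`1` with probability `p`, `0` with probability `1 - p`), the `ξ_ij`
have law `μ`, and all the `δ_ij` and `ξ_ij` together are mutually independent. -/
structure IsSparseModel {n : ℕ} {Ω : Type*} [MeasurableSpace Ω] (P : Measure Ω)
    (p : I) (μ : Measure ℝ) (δ ξ : Fin n → Fin n → Ω → ℝ) : Prop where
  law_delta : ∀ i j, HasLaw (δ i j) (bernoulliMeasure (1 : ℝ) 0 p) P
  law_xi : ∀ i j, HasLaw (ξ i j) μ P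
  indep : iIndepFun
    (Sum.elim (fun ij : Fin n × Fin n => δ ij.1 ij.2) (fun ij : Fin n × Fin n => ξ ij.1 ij.2)) P

/-- The expectation `E ν_{n,z}([0, η])`, where `ν_{n,z}` is the empirical measure of the singular
values of `(1 / √(p n)) A - z Id` and `A` has the entries `δ_ij ξ_ij`. -/
def expectedSmallMass {n : ℕ} {Ω : Type*} [MeasurableSpace Ω] (P : Measure Ω)
    (p : ℝ) (δ ξ : Fin n → Fin n → Ω → ℝ) (z : ℂ) (η : ℝ) : ℝ≥0∞ :=
  ∫⁻ ω, empiricalSingularMeasure (scaledShift p (sparseMatrix δ ξ ω) z) (Set.Icc 0 η) ∂P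

end

/-! The indicator of [0, η] is dominated by 2η²/(s² + η²), so with B the shifted matrix and m =
(1/n) Re tr η(B*B + η²)⁻¹ the mass of [0, η] is at most 2ηm (`empiricalSingularMeasure_Icc_le`). It
remains to bound E m by an absolute constant.

Write B*B = ∑ x_k x_k* with x_k the conjugated rows, let H_i omit the i-th term, and put S_i = η(H_i
+ η²)⁻¹ and t_i = (1/n) Re tr S_i. Sherman–Morrison gives m = (1/n) ∑ 1/(η + x_i* S_i x_i), and it
also gives m ≤ t_i. Multiplying the identity by (m - 1)₊ and using m ≤ 2 + (m - 1)₊ m bounds m by 2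
plus the average of (t_i - 1)₊/(η + x_i* S_i x_i) (`normalizedTrace_le_add_average`). The numerator
does not involve row i, so that row can be integrated first with H_i frozen.

The row estimate says that this integral is at most 9 (`lintegral_trace_div_quadraticForm_le`). Only
second moments of ξ are available, so x*Sx itself need not have a variance. Positivity of S gives
x*Sx ≥ Re (2x - u)*Su for every u (`re_quadraticForm_ge`); taking u to be the centred truncated row
makes the lower bound a bilinear form with one bounded factor. Its mean is at least t/4, and its
second moment about the mean is controlled by `integral_sq_bilinear_le` and the bound 1/η on the
norm of S. The deviation is O(1/(pn η²)), which is small compared with η once η³pn is large. When pn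
is below a threshold fixed by z and the law of ξ, η is bounded below and the trivial bound 1
suffices. -/

open Matrix in
/-- The matrix `η (H + η²)⁻¹`. -/
noncomputable def smoothedResolvent {n : ℕ} (η : ℝ) (H : Matrix (Fin n) (Fin n) ℂ) :
    Matrix (Fin n) (Fin n) ℂ :=
  (η : ℂ) • (H + ((η : ℂ) ^ 2) • (1 : Matrix (Fin n) (Fin n) ℂ))⁻¹

/-! ### Rank-one perturbations and the self-consistent bound for the trace. -/

section resolvent

open Matrix
open scoped ComplexOrder

variable {n : ℕ} {η : ℝ} {H : Matrix (Fin n) (Fin n) ℂ}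

lemma posDef_add_sq_smul_one (hη : 0 < η) (hH : H.PosSemidef) :
    (H + ((η : ℂ) ^ 2) • (1 : Matrix (Fin n) (Fin n) ℂ)).PosDef := by
  refine PosDef.posSemidef_add hH (PosDef.smul PosDef.one ?_)
  have : (0 : ℂ) < (η : ℂ) := by exact_mod_cast hη
  positivity

lemma posSemidef_smoothedResolvent (hη : 0 < η) (hH : H.PosSemidef) :
    (smoothedResolvent η H).PosSemidef := by
  refine PosSemidef.smul (posDef_add_sq_smul_one hη hH).inv.posSemidef ?_
  exact_mod_cast hη.le

lemma add_sq_smul_one_mul_inv (hη : 0 < η) (hH : H.PosSemidef) :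
    (H + ((η : ℂ) ^ 2) • (1 : Matrix (Fin n) (Fin n) ℂ)) *
      (H + ((η : ℂ) ^ 2) • (1 : Matrix (Fin n) (Fin n) ℂ))⁻¹ = 1 :=
  mul_nonsing_inv _ ((isUnit_iff_isUnit_det _).1 (posDef_add_sq_smul_one hη hH).isUnit)

lemma inv_mul_add_sq_smul_one (hη : 0 < η) (hH : H.PosSemidef) :
    (H + ((η : ℂ) ^ 2) • (1 : Matrix (Fin n) (Fin n) ℂ))⁻¹ *
      (H + ((η : ℂ) ^ 2) • (1 : Matrix (Fin n) (Fin n) ℂ)) = 1 :=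
  nonsing_inv_mul _ ((isUnit_iff_isUnit_det _).1 (posDef_add_sq_smul_one hη hH).isUnit)

lemma re_dotProduct_star (v w : Fin n → ℂ) :
    (v ⬝ᵥ star w).re ≤ ∑ i, ‖v i‖ * ‖w i‖ := by
  rw [dotProduct, Complex.re_sum]
  refine Finset.sum_le_sum fun i _ => (Complex.re_le_norm _).trans ?_
  simp

lemma re_dotProduct_star_self (w : Fin n → ℂ) : (w ⬝ᵥ star w).re = ∑ i, ‖w i‖ ^ 2 := by
  rw [dotProduct, Complex.re_sum]
  refine Finset.sum_congr rfl fun i _ => ?_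
  simp [Complex.mul_conj, Complex.normSq_eq_norm_sq, -Complex.ofReal_pow]

/-- This is the operator norm bound 1/η. With w = vS one has ηv = w(H + η²); pairing with w and
dropping the nonnegative H-term leaves η²‖w‖² ≤ η Re⟨v, w⟩, and the inequality between means absorbs
half of the left side. -/
lemma sum_norm_sq_vecMul_smoothedResolvent_le (hη : 0 < η) (hH : H.PosSemidef) (v : Fin n → ℂ) :
    ∑ i, ‖(v ᵥ* smoothedResolvent η H) i‖ ^ 2 ≤ (∑ i, ‖v i‖ ^ 2) / η ^ 2 := by
  set w := v ᵥ* smoothedResolvent η H with hw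
  have hv : (η : ℂ) • v = w ᵥ* (H + ((η : ℂ) ^ 2) • (1 : Matrix (Fin n) (Fin n) ℂ)) := by
    rw [hw, smoothedResolvent, vecMul_smul, smul_vecMul, vecMul_vecMul,
      inv_mul_add_sq_smul_one hη hH, vecMul_one]
  have h1 : 0 ≤ (w ᵥ* H ⬝ᵥ star w).re := by
    have := hH.re_dotProduct_nonneg (star w)
    rwa [star_star, dotProduct_mulVec] at this
  have h2 : η * (v ⬝ᵥ star w).re = (w ᵥ* H ⬝ᵥ star w).re + η ^ 2 * ∑ i, ‖w i‖ ^ 2 := by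
    have := congrArg (fun y => (y ⬝ᵥ star w).re) hv
    simp only [smul_dotProduct, vecMul_add, add_dotProduct, vecMul_smul, vecMul_one,
      Complex.add_re] at this
    rw [← re_dotProduct_star_self]
    simpa [← Complex.ofReal_pow] using this
  have h3 : η * (v ⬝ᵥ star w).re ≤ (∑ i, ‖v i‖ ^ 2) / 2 + η ^ 2 * (∑ i, ‖w i‖ ^ 2) / 2 := by
    calc η * (v ⬝ᵥ star w).re ≤ η * ∑ i, ‖v i‖ * ‖w i‖ := by
          gcongr; exact re_dotProduct_star v w
      _ ≤ _ := by
          rw [Finset.mul_sum, Finset.mul_sum, Finset.sum_div, Finset.sum_div,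
            ← Finset.sum_add_distrib]
          refine Finset.sum_le_sum fun i _ => ?_
          nlinarith [sq_nonneg (‖v i‖ - η * ‖w i‖)]
  rw [le_div_iff₀ (by positivity)]
  nlinarith

/-- The **Sherman–Morrison formula** for the quadratic form of a resolvent. -/
lemma inv_add_quadraticForm_smoothedResolvent (hη : 0 < η) (hH : H.PosSemidef) (x : Fin n → ℂ) :
    1 / (η + (star x ⬝ᵥ smoothedResolvent η H *ᵥ x).re) =
        η⁻¹ * (1 - η⁻¹ *
          (star x ⬝ᵥ smoothedResolvent η (H + vecMulVec x (star x)) *ᵥ x).re) ∧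
      (smoothedResolvent η (H + vecMulVec x (star x))).trace.re ≤
        (smoothedResolvent η H).trace.re := by
  set E : Matrix (Fin n) (Fin n) ℂ := ((η : ℂ) ^ 2) • (1 : Matrix (Fin n) (Fin n) ℂ) with hE
  have hH' : (H + vecMulVec x (star x)).PosSemidef := hH.add (posSemidef_vecMulVec_self_star x)
  set G := (H + E)⁻¹ with hG
  set G' := (H + vecMulVec x (star x) + E)⁻¹ with hG'
  have hGp : G.PosSemidef := (posDef_add_sq_smul_one hη hH).inv.posSemidef
  set q := star x ⬝ᵥ G *ᵥ x with hq
  have hq0 : 0 ≤ q := hGp.dotProduct_mulVec_nonneg x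
  have hqre : (q.re : ℂ) = q := by
    rw [Complex.ext_iff]; simpa using (Complex.le_def.1 hq0).2
  have hqr : 0 ≤ q.re := (Complex.le_def.1 hq0).1
  have hq1 : (1 + q) ≠ 0 := by
    rw [← hqre]
    have : (1 + q.re) ≠ 0 := by positivity
    exact_mod_cast this
  -- The perturbed matrix sends Gx to a multiple of x, so G'x is Gx divided by 1 + q. Both claims
  -- follow from this.
  have hKG : (H + vecMulVec x (star x) + E) *ᵥ (G *ᵥ x) = (1 + q) • x := by
    have h1 : (H + E) *ᵥ (G *ᵥ x) = x := by
      rw [mulVec_mulVec, hG, hE, add_sq_smul_one_mul_inv hη hH, one_mulVec]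
    rw [add_right_comm, add_mulVec, h1, vecMulVec_mulVec, ← hq]
    ext i
    simp only [Pi.add_apply, Pi.smul_apply, op_smul_eq_smul, smul_eq_mul]
    ring
  have hGx : G *ᵥ x = (1 + q) • (G' *ᵥ x) := by
    rw [← mulVec_smul, ← hKG, mulVec_mulVec, hG', hE, inv_mul_add_sq_smul_one hη hH', one_mulVec]
  have hG'x : G' *ᵥ x = (1 + q)⁻¹ • (G *ᵥ x) := by
    rw [hGx, smul_smul, inv_mul_cancel₀ hq1, one_smul]
  have hS : smoothedResolvent η H = (η : ℂ) • G := rfl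
  have hS' : smoothedResolvent η (H + vecMulVec x (star x)) = (η : ℂ) • G' := rfl
  constructor
  · have h1 : (star x ⬝ᵥ smoothedResolvent η H *ᵥ x).re = η * q.re := by
      rw [hS, smul_mulVec, dotProduct_smul, ← hq]; simp
    have h2 : (star x ⬝ᵥ smoothedResolvent η (H + vecMulVec x (star x)) *ᵥ x).re =
        η * (q.re / (1 + q.re)) := by
      rw [hS', smul_mulVec, hG'x, dotProduct_smul, dotProduct_smul, ← hq, ← hqre]
      have : ((η : ℂ) • (1 + (q.re : ℂ))⁻¹ • (q.re : ℂ)) = ((η * (q.re / (1 + q.re)) : ℝ) : ℂ) := by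
        push_cast; simp only [smul_eq_mul]; ring
      rw [this, Complex.ofReal_re, Complex.ofReal_re]
    rw [h1, h2]
    field_simp
    ring
  -- By the resolvent identity the trace drops by x*G²x/(1 + q), which is nonnegative.
  · have h1 : G - G' = G' * vecMulVec x (star x) * G := by
      calc G - G' = G' * (H + vecMulVec x (star x) + E) * G - G' * ((H + E) * G) := by
            rw [hG', hE, inv_mul_add_sq_smul_one hη hH', hG, hE, add_sq_smul_one_mul_inv hη hH,
              one_mul, mul_one]
        _ = _ := by noncomm_ring
    have h2 : G.trace - G'.trace = (1 + q)⁻¹ * (star x ⬝ᵥ (G * G) *ᵥ x) := by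
      rw [← trace_sub, h1, mul_assoc, vecMulVec_mul, mul_vecMulVec, trace_vecMulVec, hG'x,
        smul_dotProduct, smul_eq_mul, dotProduct_comm, ← dotProduct_mulVec, mulVec_mulVec]
    have h3 : 0 ≤ star x ⬝ᵥ (G * G) *ᵥ x := by
      have : (G * G).PosSemidef := by
        nth_rw 1 [← hGp.isHermitian]
        exact posSemidef_conjTranspose_mul_self G
      exact this.dotProduct_mulVec_nonneg x
    have h4 : 0 ≤ G.trace - G'.trace := by
      rw [h2, ← hqre]
      refine mul_nonneg ?_ h3
      have : 0 ≤ (1 + q.re)⁻¹ := by positivity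
      exact_mod_cast this
    have h5 := (Complex.le_def.1 h4).1
    simp only [Complex.zero_re, Complex.sub_re] at h5
    rw [hS, hS', trace_smul, trace_smul]
    simp only [smul_eq_mul, Complex.re_ofReal_mul]
    nlinarith

/-- Sherman–Morrison turns each summand into η⁻¹(1 - η⁻¹ x_i* S x_i) with the full resolvent S. The
forms x_i* S x_i add up to tr(FS), and FS = η - η²S. -/
lemma trace_smoothedResolvent_eq_sum (hη : 0 < η) (x : Fin n → Fin n → ℂ) :
    (smoothedResolvent η (∑ k, vecMulVec (x k) (star (x k)))).trace.re =
      ∑ i, 1 / (η + (star (x i) ⬝ᵥ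
        smoothedResolvent η (∑ k ∈ Finset.univ.erase i, vecMulVec (x k) (star (x k))) *ᵥ x i).re)
    := by
  have hp (s : Finset (Fin n)) : (∑ k ∈ s, vecMulVec (x k) (star (x k))).PosSemidef :=
    posSemidef_sum _ fun k _ => posSemidef_vecMulVec_self_star (x k)
  set F := ∑ k, vecMulVec (x k) (star (x k)) with hF
  have h1 (i : Fin n) : 1 / (η + (star (x i) ⬝ᵥ
        smoothedResolvent η (∑ k ∈ Finset.univ.erase i, vecMulVec (x k) (star (x k))) *ᵥ x i).re) =
        η⁻¹ * (1 - η⁻¹ * (star (x i) ⬝ᵥ smoothedResolvent η F *ᵥ x i).re) := by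
    rw [(inv_add_quadraticForm_smoothedResolvent hη (hp _) (x i)).1,
      Finset.sum_erase_add _ _ (Finset.mem_univ i)]
  have h2 : ∑ i, (star (x i) ⬝ᵥ smoothedResolvent η F *ᵥ x i) =
      η * n - η ^ 2 * (smoothedResolvent η F).trace := by
    have h3 : F * smoothedResolvent η F = (η : ℂ) • (1 : Matrix (Fin n) (Fin n) ℂ) -
        ((η : ℂ) ^ 2) • smoothedResolvent η F := by
      have := add_sq_smul_one_mul_inv hη (hp Finset.univ)
      rw [← hF, add_mul] at this
      rw [smul_mul_assoc, one_mul] at this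
      rw [smoothedResolvent, mul_smul_comm, eq_sub_of_add_eq this, smul_sub, smul_comm]
    have h4 := congrArg trace h3
    rw [trace_sub, trace_smul, trace_smul, trace_one, hF, Finset.sum_mul, trace_sum, ← hF] at h4
    simp only [vecMulVec_mul, trace_vecMulVec, smul_eq_mul, Fintype.card_fin] at h4
    rw [← h4]
    refine Finset.sum_congr rfl fun i _ => ?_
    rw [dotProduct_mulVec, dotProduct_comm]
  have h3 := congrArg Complex.re h2
  rw [Complex.re_sum] at h3
  simp only [h1, ← Finset.mul_sum, Finset.sum_sub_distrib, h3]
  simp [← Complex.ofReal_pow]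
  field_simp
  ring

/-- The normalised trace of the resolvent, `(η / n) Re tr (H + η²)⁻¹`. -/
noncomputable def normalizedTrace (η : ℝ) (H : Matrix (Fin n) (Fin n) ℂ) : ℝ :=
  (smoothedResolvent η H).trace.re / n

/-- The factor (m - 1)₊ is put into the trace identity and then enlarged, by monotonicity of the
trace under removal of x_i, to a quantity independent of x_i. This decouples numerator and row, and
it makes the numerator vanish when the trace is too small for concentration to help. -/
lemma normalizedTrace_le_add_average (hη : 0 < η) (hn : 0 < n) (x : Fin n → Fin n → ℂ) :
    normalizedTrace η (∑ k, vecMulVec (x k) (star (x k))) ≤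
      2 + (n : ℝ)⁻¹ * ∑ i, max 0 (normalizedTrace η
          (∑ k ∈ Finset.univ.erase i, vecMulVec (x k) (star (x k))) - 1) /
        (η + (star (x i) ⬝ᵥ smoothedResolvent η
          (∑ k ∈ Finset.univ.erase i, vecMulVec (x k) (star (x k))) *ᵥ x i).re) := by
  have hp (s : Finset (Fin n)) : (∑ k ∈ s, vecMulVec (x k) (star (x k))).PosSemidef :=
    posSemidef_sum _ fun k _ => posSemidef_vecMulVec_self_star (x k)
  have hn' : (0 : ℝ) < n := by exact_mod_cast hn
  set m := normalizedTrace η (∑ k, vecMulVec (x k) (star (x k))) with hm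
  have h1 (i : Fin n) : max 0 (m - 1) * (1 / (η + (star (x i) ⬝ᵥ smoothedResolvent η
          (∑ k ∈ Finset.univ.erase i, vecMulVec (x k) (star (x k))) *ᵥ x i).re)) ≤
      max 0 (normalizedTrace η
          (∑ k ∈ Finset.univ.erase i, vecMulVec (x k) (star (x k))) - 1) /
        (η + (star (x i) ⬝ᵥ smoothedResolvent η
          (∑ k ∈ Finset.univ.erase i, vecMulVec (x k) (star (x k))) *ᵥ x i).re) := by
    have hq : 0 ≤ (star (x i) ⬝ᵥ smoothedResolvent η
          (∑ k ∈ Finset.univ.erase i, vecMulVec (x k) (star (x k))) *ᵥ x i).re :=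
      (posSemidef_smoothedResolvent hη (hp _)).re_dotProduct_nonneg (x i)
    have ht := (inv_add_quadraticForm_smoothedResolvent hη (hp (Finset.univ.erase i)) (x i)).2
    rw [Finset.sum_erase_add _ _ (Finset.mem_univ i)] at ht
    have ht' : m ≤ normalizedTrace η
        (∑ k ∈ Finset.univ.erase i, vecMulVec (x k) (star (x k))) := by
      rw [hm, normalizedTrace, normalizedTrace]; gcongr
    rw [mul_one_div]
    gcongr
  have h2 : max 0 (m - 1) * m ≤ (n : ℝ)⁻¹ * ∑ i, max 0 (normalizedTrace η
          (∑ k ∈ Finset.univ.erase i, vecMulVec (x k) (star (x k))) - 1) /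
        (η + (star (x i) ⬝ᵥ smoothedResolvent η
          (∑ k ∈ Finset.univ.erase i, vecMulVec (x k) (star (x k))) *ᵥ x i).re) := by
    have : m = (n : ℝ)⁻¹ * ∑ i, 1 / (η + (star (x i) ⬝ᵥ smoothedResolvent η
          (∑ k ∈ Finset.univ.erase i, vecMulVec (x k) (star (x k))) *ᵥ x i).re) := by
      rw [hm, normalizedTrace, trace_smoothedResolvent_eq_sum hη, div_eq_inv_mul]
    nth_rw 2 [this]
    rw [mul_left_comm, Finset.mul_sum]
    gcongr with i
    exact h1 i
  -- What remains is m ≤ 2 + (m - 1)₊ m: clear for m ≤ 2, and for m ≥ 2 the factor m - 1 is at least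
  -- 1.
  refine le_trans ?_ (add_le_add_right h2 2)
  rcases le_total m 2 with h | h
  · have : 0 ≤ m := by
      have := (Complex.le_def.1 (posSemidef_smoothedResolvent hη (hp Finset.univ)).trace_nonneg).1
      exact div_nonneg this hn'.le
    nlinarith [mul_nonneg (le_max_left 0 (m - 1)) this]
  · rw [max_eq_right (by linarith)]
    nlinarith

lemma Continuous.smoothedResolvent {X : Type*} [TopologicalSpace X] (hη : 0 < η)
    {K : X → Matrix (Fin n) (Fin n) ℂ} (hK : Continuous K) (hp : ∀ x, (K x).PosSemidef) :
    Continuous fun x => smoothedResolvent η (K x) := by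
  unfold _root_.smoothedResolvent
  simp only [Matrix.inv_def, Ring.inverse_eq_inv']
  have hc : Continuous fun x => K x + ((η : ℂ) ^ 2) • (1 : Matrix (Fin n) (Fin n) ℂ) :=
    hK.add continuous_const
  refine ((hc.matrix_det.inv₀ fun x => ?_).smul hc.matrix_adjugate).const_smul (η : ℂ)
  exact ((isUnit_iff_isUnit_det _).1 (posDef_add_sq_smul_one hη (hp x)).isUnit).ne_zero

end resolvent

/-! ### From singular values to the trace of the resolvent. -/

section singularValues

open Matrix
open scoped ComplexOrder InnerProductSpace

variable {n : ℕ} {η : ℝ}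

lemma trace_eq_trace_toEuclideanLin (G : Matrix (Fin n) (Fin n) ℂ) :
    G.trace = LinearMap.trace ℂ _ (toEuclideanLin G) := by
  rw [LinearMap.trace_eq_sum_inner _ (EuclideanSpace.basisFun (Fin n) ℂ)]
  simp [trace, EuclideanSpace.inner_single_left, toEuclideanLin, toLpLin_apply]

/-- An orthonormal eigenbasis of B*B, with eigenvalues the squared singular values, also
diagonalises the resolvent; the trace is evaluated in it. -/
lemma trace_smoothedResolvent_conjTranspose_mul_self (hη : 0 < η) (B : Matrix (Fin n) (Fin n) ℂ) :
    (smoothedResolvent η (Bᴴ * B)).trace.re =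
      ∑ i : Fin n, η / ((toEuclideanLin B).singularValues (i : ℕ) ^ 2 + η ^ 2) := by
  set T := toEuclideanLin B with hT
  have hn : Module.finrank ℂ (EuclideanSpace ℂ (Fin n)) = n := finrank_euclideanSpace_fin
  have hsym := T.isSymmetric_adjoint_comp_self
  set G := (Bᴴ * B + ((η : ℂ) ^ 2) • (1 : Matrix (Fin n) (Fin n) ℂ))⁻¹ with hG
  have hinv : G * (Bᴴ * B + ((η : ℂ) ^ 2) • (1 : Matrix (Fin n) (Fin n) ℂ)) = 1 :=
    inv_mul_add_sq_smul_one hη (posSemidef_conjTranspose_mul_self B)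
  have hlin (v : EuclideanSpace ℂ (Fin n)) :
      toEuclideanLin G ((LinearMap.adjoint T ∘ₗ T) v + ((η : ℂ) ^ 2) • v) = v := by
    have h1 : (LinearMap.adjoint T ∘ₗ T) v + ((η : ℂ) ^ 2) • v =
        toEuclideanLin (Bᴴ * B + ((η : ℂ) ^ 2) • (1 : Matrix (Fin n) (Fin n) ℂ)) v := by
      rw [hT, ← toEuclideanLin_conjTranspose_eq_adjoint]
      ext i
      simp [toEuclideanLin, toLpLin_apply]
    rw [h1]
    have h2 := congrArg (fun M => M *ᵥ (WithLp.ofLp v)) hinv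
    ext i
    simp only [← mulVec_mulVec, add_mulVec, smul_mulVec, one_mulVec] at h2
    simpa [toEuclideanLin, toLpLin_apply] using congrFun h2 i
  have heig (i : Fin n) : toEuclideanLin G (hsym.eigenvectorBasis hn i) =
      (((T.singularValues (i : ℕ) ^ 2 + η ^ 2)⁻¹ : ℝ) : ℂ) • hsym.eigenvectorBasis hn i := by
    have h1 := hlin (hsym.eigenvectorBasis hn i)
    rw [hsym.apply_eigenvectorBasis hn i, ← T.sq_singularValues_fin hn i, ← add_smul,
      map_smul] at h1
    have h2 : (0 : ℝ) < T.singularValues (i : ℕ) ^ 2 + η ^ 2 := by positivity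
    have h3 : ((T.singularValues (i : ℕ) ^ 2 + η ^ 2 : ℝ) : ℂ) ≠ 0 := by exact_mod_cast h2.ne'
    nth_rw 2 [← h1]
    rw [smul_smul]
    push_cast at h3 ⊢
    exact ((congrArg (fun c : ℂ => c • toEuclideanLin G (hsym.eigenvectorBasis hn i))
      (inv_mul_cancel₀ h3)).trans (one_smul ℂ _)).symm
  have htr : smoothedResolvent η (Bᴴ * B) = (η : ℂ) • G := rfl
  rw [htr, trace_smul, trace_eq_trace_toEuclideanLin,
    LinearMap.trace_eq_sum_inner _ (hsym.eigenvectorBasis hn)]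
  simp only [heig, inner_smul_right]
  simp only [inner_self_eq_norm_sq_to_K, OrthonormalBasis.norm_eq_one]
  simp only [smul_eq_mul, Complex.re_ofReal_mul, Complex.re_sum]
  rw [Finset.mul_sum]
  refine Finset.sum_congr rfl fun i _ => ?_
  simp [div_eq_mul_inv]

/-- For 0 ≤ s ≤ η one has 2η²/(s² + η²) ≥ 1. -/
lemma empiricalSingularMeasure_Icc_le (hη : 0 < η) (hn : 0 < n) (B : Matrix (Fin n) (Fin n) ℂ) :
    empiricalSingularMeasure B (Set.Icc 0 η) ≤
      ENNReal.ofReal (2 * η * normalizedTrace η (Bᴴ * B)) := by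
  have hn' : (0 : ℝ) < n := by exact_mod_cast hn
  rw [normalizedTrace, trace_smoothedResolvent_conjTranspose_mul_self hη, empiricalSingularMeasure]
  have h1 : 2 * η * ((∑ i : Fin n, η / ((toEuclideanLin B).singularValues (i : ℕ) ^ 2 + η ^ 2)) / n)
      = (n : ℝ)⁻¹ * ∑ i : Fin n,
        2 * η ^ 2 / ((toEuclideanLin B).singularValues (i : ℕ) ^ 2 + η ^ 2) := by
    rw [mul_div_assoc', Finset.mul_sum, div_eq_inv_mul]
    congr 1
    refine Finset.sum_congr rfl fun i _ => by ring
  rw [h1, ENNReal.ofReal_mul (by positivity), ENNReal.ofReal_inv_of_pos hn', ENNReal.ofReal_natCast,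
    ENNReal.ofReal_sum_of_nonneg (fun i _ => by positivity)]
  simp only [Measure.smul_apply, Measure.coe_finsetSum, Finset.sum_apply, smul_eq_mul]
  gcongr with i
  rw [Measure.dirac_apply' _ measurableSet_Icc, Set.indicator_apply]
  split_ifs with h
  · rw [Pi.one_apply, ENNReal.one_le_ofReal, le_div_iff₀ (by positivity)]
    nlinarith [h.1, h.2]
  · exact zero_le

lemma empiricalSingularMeasure_le_one (hn : 0 < n) (B : Matrix (Fin n) (Fin n) ℂ) (s : Set ℝ) :
    empiricalSingularMeasure B s ≤ 1 := by
  refine (measure_mono (Set.subset_univ s)).trans ?_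
  simp only [empiricalSingularMeasure, Measure.smul_apply, Measure.coe_finsetSum, Finset.sum_apply,
    smul_eq_mul, measure_univ, Finset.sum_const, Finset.card_univ, Fintype.card_fin, nsmul_eq_mul,
    mul_one]
  rw [ENNReal.inv_mul_cancel (by exact_mod_cast hn.ne') (ENNReal.natCast_ne_top n)]

end singularValues

/-! ### Second moments of bilinear forms in independent coordinates. -/

section bilinear

variable {X ι : Type*} [MeasurableSpace X] [Fintype ι] {κ : Measure X} [IsProbabilityMeasure κ]
  {f g : X → ℝ}

lemma memLp_two_eval (hf : MemLp f 2 κ) (j : ι) :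
    MemLp (fun r : ι → X => f (r j)) 2 (Measure.pi fun _ => κ) :=
  hf.comp_measurePreserving (measurePreserving_eval (fun _ : ι => κ) j)

lemma indepFun_eval (hf : Measurable f) (hg : Measurable g) {j k : ι} (hjk : j ≠ k) :
    IndepFun (fun r : ι → X => f (r j)) (fun r => g (r k)) (Measure.pi fun _ => κ) :=
  ((iIndepFun_pi (μ := fun _ : ι => κ) (X := fun _ x => x)
    (fun _ => aemeasurable_id)).indepFun hjk).comp hf hg

lemma integral_eval_mul_eval (hf : Measurable f) (hg : Measurable g) {j k : ι} (hjk : j ≠ k) :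
    ∫ r : ι → X, f (r j) * g (r k) ∂(Measure.pi fun _ => κ) = (∫ x, f x ∂κ) * ∫ x, g x ∂κ := by
  rw [(indepFun_eval hf hg hjk).integral_fun_mul_eq_mul_integral
      (hf.comp (measurable_pi_apply j)).aestronglyMeasurable
      (hg.comp (measurable_pi_apply k)).aestronglyMeasurable,
    integral_comp_eval (μ := fun _ : ι => κ) hf.aestronglyMeasurable,
    integral_comp_eval (μ := fun _ : ι => κ) hg.aestronglyMeasurable]

lemma memLp_two_eval_mul_eval (hf : Measurable f) (hg : Measurable g) (hf2 : MemLp f 2 κ)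
    (hg2 : MemLp g 2 κ) {j k : ι} (hjk : j ≠ k) :
    MemLp (fun r : ι → X => f (r j) * g (r k)) 2 (Measure.pi fun _ => κ) := by
  rw [memLp_two_iff_integrable_sq (by fun_prop)]
  simp only [mul_pow]
  exact (indepFun_eval (hf.pow_const 2) (hg.pow_const 2) hjk).integrable_mul
    (memLp_two_eval hf2 j).integrable_sq (memLp_two_eval hg2 k).integrable_sq

lemma integral_sq_eval_mul_eval (hf : Measurable f) (hg : Measurable g) {j k : ι} (hjk : j ≠ k) :
    ∫ r : ι → X, (f (r j) * g (r k)) ^ 2 ∂(Measure.pi fun _ => κ) =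
      (∫ x, f x ^ 2 ∂κ) * ∫ x, g x ^ 2 ∂κ := by
  simp only [mul_pow]
  exact integral_eval_mul_eval (hf.pow_const 2) (hg.pow_const 2) hjk

lemma integral_sq_sum_eval {φ : ι → X → ℝ} (hφ : ∀ i, Measurable (φ i))
    (hφ2 : ∀ i, MemLp (φ i) 2 κ) (hφ0 : ∀ i, ∫ x, φ i x ∂κ = 0) :
    ∫ r : ι → X, (∑ i, φ i (r i)) ^ 2 ∂(Measure.pi fun _ => κ) = ∑ i, ∫ x, φ i x ^ 2 ∂κ := by
  have h1 (i : ι) : ∫ r : ι → X, φ i (r i) ∂(Measure.pi fun _ => κ) = 0 := by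
    rw [integral_comp_eval (μ := fun _ : ι => κ) (hφ i).aestronglyMeasurable, hφ0]
  have h2 := IndepFun.variance_sum (μ := Measure.pi fun _ : ι => κ) (s := Finset.univ)
    (X := fun i (r : ι → X) => φ i (r i)) (fun i _ => memLp_two_eval (hφ2 i) i)
    (fun i _ j _ hij => indepFun_eval (hφ i) (hφ j) hij)
  rw [variance_of_integral_eq_zero] at h2
  · simp only [Finset.sum_apply] at h2
    rw [h2]
    refine Finset.sum_congr rfl fun i _ => ?_
    rw [variance_of_integral_eq_zero (Measurable.aemeasurable (by fun_prop)) (h1 i)]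
    exact integral_comp_eval (μ := fun _ : ι => κ) (f := fun x => φ i x ^ 2)
      ((hφ i).pow_const 2).aestronglyMeasurable
  · exact Measurable.aemeasurable (by fun_prop)
  · simp only [Finset.sum_apply]
    rw [integral_finsetSum _ fun i _ => (memLp_two_eval (hφ2 i) i).integrable one_le_two]
    simp [h1]

variable [DecidableEq ι]

/-- If the index pairs differ as unordered pairs, then j or k occurs exactly once among the four
indices, and integrating that coordinate gives a centred factor. -/
lemma integral_eval_mul_four_eq_zero (hf0 : ∫ x, f x ∂κ = 0) (hg0 : ∫ x, g x ∂κ = 0)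
    {j k j' k' : ι} (hjk : j ≠ k) (h1 : ¬ (j' = j ∧ k' = k))
    (h2 : ¬ (j' = k ∧ k' = j)) :
    ∫ r : ι → X, (f (r j) * g (r k)) * (f (r j') * g (r k')) ∂(Measure.pi fun _ => κ) = 0 := by
  -- Writing the product over all coordinates, with 1 at the unused ones, lets the integral factor.
  have h (r : ι → X) : (f (r j) * g (r k)) * (f (r j') * g (r k')) =
      ∏ l, ((if l = j then f (r l) else 1) * (if l = k then g (r l) else 1) *
        ((if l = j' then f (r l) else 1) * (if l = k' then g (r l) else 1))) := by
    rw [Finset.prod_mul_distrib, Finset.prod_mul_distrib, Finset.prod_mul_distrib]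
    simp
  simp only [h]
  rw [integral_fintype_prod_eq_prod (fun l (x : X) =>
    ((if l = j then f x else 1) * (if l = k then g x else 1) *
        ((if l = j' then f x else 1) * (if l = k' then g x else 1))))]
  by_cases hj : j = j' ∨ j = k'
  · refine Finset.prod_eq_zero (Finset.mem_univ k) ?_
    have e1 : k ≠ j' := by grind
    have e2 : k ≠ k' := by grind
    simp [hjk.symm, e1, e2, hg0]
  · refine Finset.prod_eq_zero (Finset.mem_univ j) ?_
    have e1 : j ≠ j' := by grind
    have e2 : j ≠ k' := by grind
    simp [hjk, e1, e2, hf0]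

/-- After expanding the square, a pair P has nonzero covariance only with itself and with its swap.
The swapped term is bounded by 2ab ≤ a² + b², which accounts for the factor 2. -/
lemma integral_sq_offDiag_le (hf : Measurable f) (hg : Measurable g) (hf2 : MemLp f 2 κ)
    (hg2 : MemLp g 2 κ) (hf0 : ∫ x, f x ∂κ = 0) (hg0 : ∫ x, g x ∂κ = 0) (T : ι → ι → ℝ) :
    ∫ r : ι → X, (∑ P ∈ Finset.univ.offDiag, T P.1 P.2 * (f (r P.1) * g (r P.2))) ^ 2
      ∂(Measure.pi fun _ => κ) ≤
      2 * ((∫ x, f x ^ 2 ∂κ) * ∫ x, g x ^ 2 ∂κ) * ∑ j, ∑ k, T j k ^ 2 := by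
  set AB := (∫ x, f x ^ 2 ∂κ) * ∫ x, g x ^ 2 ∂κ with hAB
  have hAB0 : 0 ≤ AB := mul_nonneg (integral_nonneg fun _ => sq_nonneg _)
    (integral_nonneg fun _ => sq_nonneg _)
  have hmem {P : ι × ι} (hP : P ∈ (Finset.univ : Finset ι).offDiag) :=
    memLp_two_eval_mul_eval hf hg hf2 hg2 (Finset.mem_offDiag.1 hP).2.2
  have hint {P P' : ι × ι} (hP : P ∈ (Finset.univ : Finset ι).offDiag)
      (hP' : P' ∈ (Finset.univ : Finset ι).offDiag) :
      Integrable (fun r : ι → X => (T P.1 P.2 * (f (r P.1) * g (r P.2))) *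
        (T P'.1 P'.2 * (f (r P'.1) * g (r P'.2)))) (Measure.pi fun _ => κ) :=
    ((hmem hP).const_mul _).integrable_mul ((hmem hP').const_mul _)
  have hbound {P P' : ι × ι} (hP : P ∈ (Finset.univ : Finset ι).offDiag)
      (hP' : P' ∈ (Finset.univ : Finset ι).offDiag) :
      ∫ r : ι → X, (T P.1 P.2 * (f (r P.1) * g (r P.2))) *
        (T P'.1 P'.2 * (f (r P'.1) * g (r P'.2))) ∂(Measure.pi fun _ => κ) ≤
      AB * (T P.1 P.2 ^ 2 + T P'.1 P'.2 ^ 2) / 2 := by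
    have hI {P : ι × ι} (hP : P ∈ (Finset.univ : Finset ι).offDiag) :
        Integrable (fun r : ι → X => T P.1 P.2 ^ 2 * (f (r P.1) * g (r P.2)) ^ 2 / 2)
          (Measure.pi fun _ => κ) := ((hmem hP).integrable_sq.const_mul _).div_const 2
    have hV {P : ι × ι} (hP : P ∈ (Finset.univ : Finset ι).offDiag) :
        ∫ r : ι → X, T P.1 P.2 ^ 2 * (f (r P.1) * g (r P.2)) ^ 2 / 2 ∂(Measure.pi fun _ => κ) =
          T P.1 P.2 ^ 2 * AB / 2 := by
      rw [integral_div, integral_const_mul,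
        integral_sq_eval_mul_eval hf hg (Finset.mem_offDiag.1 hP).2.2]
    calc _ ≤ ∫ r : ι → X, T P.1 P.2 ^ 2 * (f (r P.1) * g (r P.2)) ^ 2 / 2 +
          T P'.1 P'.2 ^ 2 * (f (r P'.1) * g (r P'.2)) ^ 2 / 2 ∂(Measure.pi fun _ => κ) := by
          refine integral_mono (hint hP hP') ((hI hP).add (hI hP')) fun r => ?_
          have := two_mul_le_add_sq (T P.1 P.2 * (f (r P.1) * g (r P.2)))
            (T P'.1 P'.2 * (f (r P'.1) * g (r P'.2)))
          simp only
          linarith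
      _ = _ := by
          rw [integral_add (hI hP) (hI hP'), hV hP, hV hP']; ring
  simp only [sq, Finset.sum_mul_sum]
  rw [integral_finsetSum _ fun P hP => integrable_finsetSum _ fun P' hP' => hint hP hP']
  have hterm {P : ι × ι} (hP : P ∈ (Finset.univ : Finset ι).offDiag) :
      ∫ r : ι → X, ∑ P' ∈ Finset.univ.offDiag, (T P.1 P.2 * (f (r P.1) * g (r P.2))) *
        (T P'.1 P'.2 * (f (r P'.1) * g (r P'.2))) ∂(Measure.pi fun _ => κ) ≤
      AB * T P.1 P.2 ^ 2 + AB * (T P.1 P.2 ^ 2 + T P.2 P.1 ^ 2) / 2 := by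
    rw [integral_finsetSum _ fun P' hP' => hint hP hP']
    have hPs : P.swap ∈ (Finset.univ : Finset ι).offDiag := by
      simpa [eq_comm] using hP
    have hne : P ≠ P.swap := fun h => (Finset.mem_offDiag.1 hP).2.2 (congrArg Prod.fst h)
    calc _ ≤ ∑ P' ∈ ({P, P.swap} : Finset (ι × ι)), ∫ r : ι → X,
          (T P.1 P.2 * (f (r P.1) * g (r P.2))) *
            (T P'.1 P'.2 * (f (r P'.1) * g (r P'.2))) ∂(Measure.pi fun _ => κ) := by
          refine (Finset.sum_subset ?_ fun P' hP' hP'' => ?_).ge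
          · intro Q hQ
            rcases Finset.mem_insert.1 hQ with rfl | hQ
            · exact hP
            · rw [Finset.mem_singleton.1 hQ]; exact hPs
          · have e : ∀ r : ι → X, (T P.1 P.2 * (f (r P.1) * g (r P.2))) *
              (T P'.1 P'.2 * (f (r P'.1) * g (r P'.2))) = (T P.1 P.2 * T P'.1 P'.2) *
                ((f (r P.1) * g (r P.2)) * (f (r P'.1) * g (r P'.2))) := fun r => by ring
            simp only [e]
            rw [integral_const_mul, integral_eval_mul_four_eq_zero hf0 hg0
              (Finset.mem_offDiag.1 hP).2.2, mul_zero]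
            · rintro ⟨a, b⟩
              exact hP'' (by simp [Prod.ext_iff, a, b])
            · rintro ⟨a, b⟩
              exact hP'' (by simp [Prod.ext_iff, a, b])
      _ ≤ _ := by
          rw [Finset.sum_pair hne]
          refine add_le_add ((hbound hP hP).trans (by linarith)) (hbound hP hPs)
  refine (Finset.sum_le_sum fun P hP => hterm hP).trans ?_
  have hle : ∑ P ∈ (Finset.univ : Finset ι).offDiag,
      (AB * T P.1 P.2 ^ 2 + AB * (T P.1 P.2 ^ 2 + T P.2 P.1 ^ 2) / 2) ≤
      ∑ P : ι × ι, (AB * T P.1 P.2 ^ 2 + AB * (T P.1 P.2 ^ 2 + T P.2 P.1 ^ 2) / 2) :=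
    Finset.sum_le_sum_of_subset_of_nonneg (Finset.subset_univ _) fun P _ _ => by positivity
  refine hle.trans (le_of_eq ?_)
  simp only [mul_add, add_div, Finset.sum_add_distrib, Fintype.sum_prod_type, ← Finset.mul_sum,
    ← Finset.sum_div]
  rw [Finset.sum_comm (f := fun j k => T k j ^ 2)]
  simp only [sq]
  ring

/-- The second moment of a centred bilinear form in independent pairs `(f (r j), g (r j))`. -/
lemma integral_sq_bilinear_le (hf : Measurable f) (hg : Measurable g) (hf2 : MemLp f 2 κ)
    (hg2 : MemLp g 2 κ) (hfg2 : MemLp (fun x => f x * g x) 2 κ) (hf0 : ∫ x, f x ∂κ = 0)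
    (hg0 : ∫ x, g x ∂κ = 0) (T : ι → ι → ℝ) (h : ι → ℝ) :
    Integrable (fun r : ι → X => (∑ j, ∑ k, f (r j) * T j k * g (r k) + ∑ k, h k * g (r k) -
        (∫ x, f x * g x ∂κ) * ∑ j, T j j) ^ 2) (Measure.pi fun _ => κ) ∧
    ∫ r : ι → X, (∑ j, ∑ k, f (r j) * T j k * g (r k) + ∑ k, h k * g (r k) -
        (∫ x, f x * g x ∂κ) * ∑ j, T j j) ^ 2 ∂(Measure.pi fun _ => κ) ≤
      4 * (((∫ x, (f x * g x) ^ 2 ∂κ) + (∫ x, f x ^ 2 ∂κ) * ∫ x, g x ^ 2 ∂κ) *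
        (∑ j, ∑ k, T j k ^ 2) + (∫ x, g x ^ 2 ∂κ) * ∑ k, h k ^ 2) := by
  set c := ∫ x, f x * g x ∂κ with hc
  set D := ∫ x, (f x * g x) ^ 2 ∂κ with hD
  -- The diagonal terms, centred by c, are merged with the linear terms into a sum of independent
  -- mean-zero variables. The off-diagonal part is estimated separately.
  set φ : ι → X → ℝ := fun k x => T k k * (f x * g x - c) + h k * g x with hφ
  set O : (ι → X) → ℝ := fun r =>
    ∑ P ∈ Finset.univ.offDiag, T P.1 P.2 * (f (r P.1) * g (r P.2)) with hO
  have hsplit (r : ι → X) : ∑ j, ∑ k, f (r j) * T j k * g (r k) + ∑ k, h k * g (r k) -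
        c * ∑ j, T j j = ∑ k, φ k (r k) + O r := by
    have h1 : ∑ j, ∑ k, f (r j) * T j k * g (r k) =
        ∑ j, T j j * (f (r j) * g (r j)) + O r := by
      rw [← Fintype.sum_prod_type' (f := fun j k => f (r j) * T j k * g (r k)),
        ← Finset.univ_product_univ, ← Finset.diag_union_offDiag,
        Finset.sum_union (Finset.disjoint_diag_offDiag _)]
      congr 1
      · rw [Finset.sum_diag]
        exact Finset.sum_congr rfl fun _ _ => by ring
      · exact Finset.sum_congr rfl fun _ _ => by ring
    rw [h1, hφ]
    simp only [mul_sub, Finset.sum_add_distrib, Finset.sum_sub_distrib, Finset.mul_sum]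
    simp only [mul_comm c]
    ring
  have hfgc : MemLp (fun x => f x * g x - c) 2 κ := hfg2.sub (memLp_const c)
  have hφm (k : ι) : Measurable (φ k) := by fun_prop
  have hφ2 (k : ι) : MemLp (φ k) 2 κ := (hfgc.const_mul (T k k)).add (hg2.const_mul (h k))
  have hfgi : Integrable (fun x => f x * g x) κ := hfg2.integrable one_le_two
  have hφ0 (k : ι) : ∫ x, φ k x ∂κ = 0 := by
    change ∫ x, (T k k * (f x * g x - c) + h k * g x) ∂κ = 0
    rw [integral_add ((hfgc.integrable one_le_two).const_mul _)
      ((hg2.integrable one_le_two).const_mul _), integral_const_mul, integral_const_mul,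
      integral_sub hfgi (integrable_const c), hg0, ← hc]
    simp
  have hvar : ∫ x, (f x * g x - c) ^ 2 ∂κ ≤ D := by
    rw [hc, ← variance_eq_integral (X := fun x => f x * g x) (by fun_prop)]
    exact variance_le_expectation_sq (by fun_prop)
  have hφsq (k : ι) : ∫ x, φ k x ^ 2 ∂κ ≤
      2 * T k k ^ 2 * D + 2 * h k ^ 2 * ∫ x, g x ^ 2 ∂κ := by
    calc _ ≤ ∫ x, 2 * T k k ^ 2 * (f x * g x - c) ^ 2 + 2 * h k ^ 2 * g x ^ 2 ∂κ := by
          refine integral_mono (hφ2 k).integrable_sq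
            ((hfgc.integrable_sq.const_mul _).add (hg2.integrable_sq.const_mul _)) fun x => ?_
          have := two_mul_le_add_sq (T k k * (f x * g x - c)) (h k * g x)
          simp only [hφ]
          linarith
      _ ≤ _ := by
          rw [integral_add (hfgc.integrable_sq.const_mul _) (hg2.integrable_sq.const_mul _),
            integral_const_mul, integral_const_mul]
          gcongr
  have hφs2 : MemLp (fun r : ι → X => ∑ k, φ k (r k)) 2 (Measure.pi fun _ => κ) :=
    memLp_finsetSum _ fun k _ => memLp_two_eval (hφ2 k) k
  have hO2 : MemLp O 2 (Measure.pi fun _ => κ) :=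
    memLp_finsetSum _ fun P hP =>
      (memLp_two_eval_mul_eval hf hg hf2 hg2 (Finset.mem_offDiag.1 hP).2.2).const_mul _
  simp only [hsplit]
  refine ⟨(hφs2.add hO2).integrable_sq, ?_⟩
  calc _ ≤ ∫ r : ι → X, 2 * (∑ k, φ k (r k)) ^ 2 + 2 * O r ^ 2 ∂(Measure.pi fun _ => κ) := by
        refine integral_mono (hφs2.add hO2).integrable_sq
          ((hφs2.integrable_sq.const_mul 2).add (hO2.integrable_sq.const_mul 2)) fun r => ?_
        have := two_mul_le_add_sq (∑ k, φ k (r k)) (O r)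
        simp only
        linarith
    _ = 2 * ∑ k, ∫ x, φ k x ^ 2 ∂κ + 2 * ∫ r, O r ^ 2 ∂(Measure.pi fun _ => κ) := by
        rw [integral_add (hφs2.integrable_sq.const_mul 2) (hO2.integrable_sq.const_mul 2),
          integral_const_mul, integral_const_mul, integral_sq_sum_eval hφm hφ2 hφ0]
    _ ≤ 2 * ∑ k, (2 * T k k ^ 2 * D + 2 * h k ^ 2 * ∫ x, g x ^ 2 ∂κ) +
        2 * (2 * ((∫ x, f x ^ 2 ∂κ) * ∫ x, g x ^ 2 ∂κ) * ∑ j, ∑ k, T j k ^ 2) := by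
        gcongr with k
        · exact hφsq k
        · exact integral_sq_offDiag_le hf hg hf2 hg2 hf0 hg0 T
    _ ≤ _ := by
        have hdiag : ∑ k, T k k ^ 2 ≤ ∑ j, ∑ k, T j k ^ 2 :=
          Finset.sum_le_sum fun j _ =>
            Finset.single_le_sum (f := fun k => T j k ^ 2) (fun _ _ => sq_nonneg _)
              (Finset.mem_univ j)
        have hD0 : 0 ≤ D := integral_nonneg fun _ => sq_nonneg _
        rw [Finset.sum_add_distrib, ← Finset.sum_mul, ← Finset.sum_mul, ← Finset.mul_sum,
          ← Finset.mul_sum]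
        nlinarith [mul_le_mul_of_nonneg_left hdiag hD0]

end bilinear

/-! ### The quadratic form of a single random row. -/

section row

open Matrix
open scoped ComplexOrder

variable {n : ℕ} {η : ℝ}

/-- Expand (x - u)*S(x - u) ≥ 0. The gain is that u may be chosen bounded although x is not. -/
lemma re_quadraticForm_ge {S : Matrix (Fin n) (Fin n) ℂ} (hS : S.PosSemidef) (x u : Fin n → ℂ) :
    (star ((2 : ℂ) • x - u) ⬝ᵥ S *ᵥ u).re ≤ (star x ⬝ᵥ S *ᵥ x).re := by
  have h1 := hS.re_dotProduct_nonneg (x - u)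
  have h2 : (star u ⬝ᵥ S *ᵥ x).re = (star x ⬝ᵥ S *ᵥ u).re := by
    have : star u ⬝ᵥ S *ᵥ x = star (star x ⬝ᵥ S *ᵥ u) := by
      rw [star_dotProduct, star_mulVec, hS.isHermitian.eq, ← dotProduct_mulVec]
    rw [this]; simp
  simp only [star_sub, mulVec_sub, sub_dotProduct, dotProduct_sub, star_smul, smul_dotProduct,
    RCLike.re_to_complex, Complex.sub_re] at h1 ⊢
  have h3 : (star (2 : ℂ) • (star x ⬝ᵥ S *ᵥ u)).re = 2 * (star x ⬝ᵥ S *ᵥ u).re := by simp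
  rw [h3]
  linarith

lemma re_dotProduct_mulVec_ofReal (S : Matrix (Fin n) (Fin n) ℂ) (a u : Fin n → ℝ)
    (y : Fin n → ℂ) :
    (((fun j => (a j : ℂ)) + y) ⬝ᵥ S *ᵥ (fun k => (u k : ℂ))).re =
      ∑ j, ∑ k, a j * (S j k).re * u k + ∑ k, ((y ᵥ* S) k).re * u k := by
  rw [add_dotProduct, Complex.add_re]
  congr 1
  · simp only [dotProduct, mulVec, Finset.mul_sum, Complex.re_sum]
    refine Finset.sum_congr rfl fun j _ => Finset.sum_congr rfl fun k _ => ?_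
    simp [mul_assoc]
  · rw [dotProduct_mulVec, dotProduct, Complex.re_sum]
    refine Finset.sum_congr rfl fun k _ => ?_
    simp

/-- Each row of S is a unit vector times S, hence of norm at most 1/η. -/
lemma sum_sq_re_smoothedResolvent_le {H : Matrix (Fin n) (Fin n) ℂ} (hη : 0 < η)
    (hH : H.PosSemidef) : ∑ j, ∑ k, (smoothedResolvent η H j k).re ^ 2 ≤ n / η ^ 2 := by
  have h1 (j : Fin n) : ∑ k, (smoothedResolvent η H j k).re ^ 2 ≤ 1 / η ^ 2 := by
    have h := sum_norm_sq_vecMul_smoothedResolvent_le hη hH (Pi.single j 1)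
    rw [single_one_vecMul] at h
    have h2 : ∑ i, ‖(Pi.single j 1 : Fin n → ℂ) i‖ ^ 2 = 1 := by
      rw [Finset.sum_eq_single j] <;> simp +contextual
    rw [h2] at h
    refine (Finset.sum_le_sum fun k _ => ?_).trans h
    rw [sq_le_sq, abs_of_nonneg (norm_nonneg _)]
    exact Complex.abs_re_le_norm _
  calc _ ≤ ∑ _j : Fin n, 1 / η ^ 2 := Finset.sum_le_sum fun j _ => h1 j
    _ = _ := by simp; ring

lemma sum_sq_re_vecMul_smoothedResolvent_le {H : Matrix (Fin n) (Fin n) ℂ} (hη : 0 < η)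
    (hH : H.PosSemidef) (b : ℝ) (w : Fin n → ℂ) :
    ∑ k, (((fun j => (b : ℂ) - 2 * star (w j)) ᵥ* smoothedResolvent η H) k).re ^ 2 ≤
      (2 * n * b ^ 2 + 8 * ∑ j, ‖w j‖ ^ 2) / η ^ 2 := by
  calc _ ≤ ∑ k, ‖((fun j => (b : ℂ) - 2 * star (w j)) ᵥ* smoothedResolvent η H) k‖ ^ 2 := by
        refine Finset.sum_le_sum fun k _ => ?_
        rw [sq_le_sq, abs_of_nonneg (norm_nonneg _)]
        exact Complex.abs_re_le_norm _
    _ ≤ (∑ j, ‖(b : ℂ) - 2 * star (w j)‖ ^ 2) / η ^ 2 :=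
        sum_norm_sq_vecMul_smoothedResolvent_le hη hH _
    _ ≤ (∑ j, (2 * b ^ 2 + 8 * ‖w j‖ ^ 2)) / η ^ 2 := by
        gcongr with j
        have h1 : ‖(b : ℂ) - 2 * star (w j)‖ ≤ |b| + 2 * ‖w j‖ := by
          refine (norm_sub_le _ _).trans ?_
          simp
        calc ‖(b : ℂ) - 2 * star (w j)‖ ^ 2 ≤ (|b| + 2 * ‖w j‖) ^ 2 := by gcongr
          _ ≤ _ := by
            rw [← sq_abs b]
            nlinarith [sq_nonneg (|b| - 2 * ‖w j‖)]
    _ = _ := by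
        simp only [Finset.sum_add_distrib, ← Finset.mul_sum, Finset.sum_const, Finset.card_univ, Fintype.card_fin, nsmul_eq_mul]
        ring

/-- A random row `a (r j) - w j` whose entries have truncations `g (r j)` makes its quadratic form
comparable with the normalised trace, in the mean of the reciprocal. -/
lemma lintegral_trace_div_quadraticForm_le {κ : Measure ℝ} [IsProbabilityMeasure κ]
    {f g a : ℝ → ℝ} {b : ℝ} (hf : Measurable f) (hg : Measurable g) (hf2 : MemLp f 2 κ)
    (hg2 : MemLp g 2 κ) (hfg2 : MemLp (fun x => f x * g x) 2 κ) (hf0 : ∫ x, f x ∂κ = 0)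
    (hg0 : ∫ x, g x ∂κ = 0) (hab : ∀ x, 2 * a x = f x + g x + b) (w : Fin n → ℂ)
    {H : Matrix (Fin n) (Fin n) ℂ} (hη : 0 < η) (hH : H.PosSemidef) (hn : 0 < n)
    (hc : 1 / (4 * n) ≤ ∫ x, f x * g x ∂κ)
    (hV : 4 * (((∫ x, (f x * g x) ^ 2 ∂κ) + (∫ x, f x ^ 2 ∂κ) * ∫ x, g x ^ 2 ∂κ) * (n / η ^ 2) +
      (∫ x, g x ^ 2 ∂κ) * ((2 * n * b ^ 2 + 8 * ∑ j, ‖w j‖ ^ 2) / η ^ 2)) ≤ η / 64) :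
    ∫⁻ r : Fin n → ℝ, ENNReal.ofReal (max 0 (normalizedTrace η H - 1) /
      (η + (star (fun j => (a (r j) : ℂ) - w j) ⬝ᵥ
        smoothedResolvent η H *ᵥ (fun j => (a (r j) : ℂ) - w j)).re))
      ∂(Measure.pi fun _ => κ) ≤ ENNReal.ofReal 9 := by
  have hn' : (0 : ℝ) < n := by exact_mod_cast hn
  set t := normalizedTrace η H with ht
  set S := smoothedResolvent η H with hS
  have hSp : S.PosSemidef := posSemidef_smoothedResolvent hη hH
  rcases le_or_gt t 1 with ht1 | ht1
  · simp [max_eq_left (sub_nonpos.2 ht1)]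
  set h : Fin n → ℝ := fun k => (((fun j => (b : ℂ) - 2 * star (w j)) ᵥ* S) k).re with hh
  set c := ∫ x, f x * g x ∂κ with hcdef
  set dev : (Fin n → ℝ) → ℝ := fun r => ∑ j, ∑ k, f (r j) * (S j k).re * g (r k) +
    ∑ k, h k * g (r k) - c * ∑ j, (S j j).re with hdev
  obtain ⟨hdevI, hdevV⟩ :=
    integral_sq_bilinear_le hf hg hf2 hg2 hfg2 hf0 hg0 (fun j k => (S j k).re) h
  have hvar : ∫ r, dev r ^ 2 ∂(Measure.pi fun _ => κ) ≤ η / 64 := by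
    refine hdevV.trans (le_trans ?_ hV)
    have h1 := sum_sq_re_smoothedResolvent_le hη hH
    have h2 := sum_sq_re_vecMul_smoothedResolvent_le hη hH b w
    have i1 : 0 ≤ ∫ x, (f x * g x) ^ 2 ∂κ := integral_nonneg fun _ => sq_nonneg _
    have i2 : 0 ≤ ∫ x, f x ^ 2 ∂κ := integral_nonneg fun _ => sq_nonneg _
    have i3 : 0 ≤ ∫ x, g x ^ 2 ∂κ := integral_nonneg fun _ => sq_nonneg _
    gcongr
  have htr : ∑ j, (S j j).re = n * t := by
    rw [ht, normalizedTrace, mul_div_cancel₀ _ hn'.ne', trace, Complex.re_sum]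
    rfl
  have hct : t / 4 ≤ c * ∑ j, (S j j).re := by
    have := mul_le_mul_of_nonneg_right hc (mul_nonneg hn'.le (by linarith : 0 ≤ t))
    rw [htr]
    refine le_trans (le_of_eq ?_) this
    field_simp
  -- If the bilinear lower bound L is at least t/8, the ratio is at most 8. Otherwise the deviation
  -- from a mean of at least t/4 exceeds t/8, and since t > 1 the crude bound t/η is at most t²/η ≤
  -- 64 dev²/η. With variance at most η/64 the total is 8 + 1.
  have hpt (r : Fin n → ℝ) : max 0 (t - 1) /
      (η + (star (fun j => (a (r j) : ℂ) - w j) ⬝ᵥ S *ᵥ (fun j => (a (r j) : ℂ) - w j)).re) ≤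
      8 + 64 / η * dev r ^ 2 := by
    set x : Fin n → ℂ := fun j => (a (r j) : ℂ) - w j with hx
    have hQ0 : 0 ≤ (star x ⬝ᵥ S *ᵥ x).re := hSp.re_dotProduct_nonneg x
    have hL : ∑ j, ∑ k, f (r j) * (S j k).re * g (r k) + ∑ k, h k * g (r k) ≤
        (star x ⬝ᵥ S *ᵥ x).re := by
      refine le_trans (le_of_eq ?_) (re_quadraticForm_ge hSp x fun k => (g (r k) : ℂ))
      have : star ((2 : ℂ) • x - fun k => (g (r k) : ℂ)) =
          (fun j => (f (r j) : ℂ)) + fun j => (b : ℂ) - 2 * star (w j) := by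
        ext j
        have hj : (2 : ℂ) * a (r j) = f (r j) + g (r j) + b := by exact_mod_cast hab (r j)
        simp only [hx, Pi.star_apply, Pi.sub_apply, Pi.smul_apply, smul_eq_mul, Pi.add_apply,
          mul_sub, hj]
        simp
        ring
      rw [this, re_dotProduct_mulVec_ofReal]
    set Q := (star x ⬝ᵥ S *ᵥ x).re
    set L := ∑ j, ∑ k, f (r j) * (S j k).re * g (r k) + ∑ k, h k * g (r k) with hLdef
    have hdr : dev r = L - c * ∑ j, (S j j).re := rfl
    rw [max_eq_right (by linarith), div_le_iff₀ (by positivity)]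
    have hd0 : 0 ≤ 64 / η * dev r ^ 2 := by positivity
    rcases le_or_gt (t / 8) L with hcase | hcase
    · nlinarith
    · have h1 : t / 8 ≤ -dev r := by rw [hdr]; linarith
      have h2 : t ^ 2 ≤ 64 * dev r ^ 2 := by nlinarith
      have h3 : t ≤ 64 / η * dev r ^ 2 * η := by
        have : 64 / η * dev r ^ 2 * η = 64 * dev r ^ 2 := by field_simp
        rw [this]; nlinarith
      nlinarith [mul_nonneg hd0 hQ0]
  have hI : Integrable (fun r => 64 / η * dev r ^ 2) (Measure.pi fun _ => κ) :=
    hdevI.const_mul _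
  have hI8 : Integrable (fun r => 8 + 64 / η * dev r ^ 2) (Measure.pi fun _ => κ) :=
    (integrable_const 8).add hI
  calc _ ≤ ∫⁻ r, ENNReal.ofReal (8 + 64 / η * dev r ^ 2) ∂(Measure.pi fun _ => κ) :=
        lintegral_mono fun r => ENNReal.ofReal_le_ofReal (hpt r)
    _ = ENNReal.ofReal (∫ r, (8 + 64 / η * dev r ^ 2) ∂(Measure.pi fun _ => κ)) := by
        rw [ofReal_integral_eq_lintegral_ofReal hI8]
        exact Eventually.of_forall fun r => by positivity
    _ ≤ _ := by
        apply ENNReal.ofReal_le_ofReal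
        rw [integral_add (integrable_const _) hI, integral_const_mul]
        simp only [integral_const, probReal_univ, one_smul]
        have : 64 / η * ∫ r, dev r ^ 2 ∂(Measure.pi fun _ => κ) ≤ 64 / η * (η / 64) := by gcongr
        have e : 64 / η * (η / 64) = 1 := by field_simp
        linarith

end row

/-! ### The sparse matrix as a product measure, and integration over its rows. -/

section model

open Matrix
open scoped ComplexOrder

/-- The law of a product of a Bernoulli variable and an independent variable of law `μ`. -/
noncomputable def sparseEntryLaw (p : I) (μ : Measure ℝ) : Measure ℝ :=
  ((bernoulliMeasure (1 : ℝ) 0 p).prod μ).map fun q => q.1 * q.2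

instance (p : I) (μ : Measure ℝ) [IsProbabilityMeasure μ] :
    IsProbabilityMeasure (sparseEntryLaw p μ) :=
  Measure.isProbabilityMeasure_map (by fun_prop)

lemma sparseEntryLaw_eq (p : I) (μ : Measure ℝ) [IsProbabilityMeasure μ] :
    sparseEntryLaw p μ =
      unitInterval.toNNReal p • μ + unitInterval.toNNReal (σ p) • Measure.dirac 0 := by
  have hm : Measurable fun q : ℝ × ℝ => q.1 * q.2 := by fun_prop
  rw [sparseEntryLaw, bernoulliMeasure_def, Measure.add_prod, Measure.map_add _ _ hm]
  congr 1
  · rw [Measure.prod_smul_left, Measure.map_smul, Measure.dirac_prod,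
      Measure.map_map hm (by fun_prop)]
    simp [Function.comp_def]
  · rw [Measure.prod_smul_left, Measure.map_smul, Measure.dirac_prod,
      Measure.map_map hm (by fun_prop)]
    simp [Function.comp_def]

lemma integrable_sparseEntryLaw (p : I) {μ : Measure ℝ} [IsProbabilityMeasure μ] {h : ℝ → ℝ}
    (hh : Integrable h μ) : Integrable h (sparseEntryLaw p μ) := by
  rw [sparseEntryLaw_eq]
  exact hh.smul_measure_nnreal.add_measure (integrable_dirac (by simp)).smul_measure_nnreal

lemma integral_sparseEntryLaw (p : I) {μ : Measure ℝ} [IsProbabilityMeasure μ] {h : ℝ → ℝ}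
    (hh : Integrable h μ) (h0 : h 0 = 0) : ∫ x, h x ∂(sparseEntryLaw p μ) = p * ∫ x, h x ∂μ := by
  rw [sparseEntryLaw_eq, integral_add_measure hh.smul_measure_nnreal
    (integrable_dirac (by simp)).smul_measure_nnreal]
  simp [h0, NNReal.smul_def]

/-- The product law over the disjoint union of the two index sets is regrouped into pairs (δ_ij,
ξ_ij), and multiplication is applied to each pair separately. -/
lemma IsSparseModel.hasLaw_entries {n : ℕ} {Ω : Type*} [MeasurableSpace Ω] {P : Measure Ω}
    {p : I} {μ : Measure ℝ} [IsProbabilityMeasure μ] {δ ξ : Fin n → Fin n → Ω → ℝ}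
    (h : IsSparseModel P p μ δ ξ) :
    HasLaw (fun ω i j => δ i j ω * ξ i j ω)
      (Measure.pi fun _ : Fin n => Measure.pi fun _ : Fin n => sparseEntryLaw p μ) P := by
  let ν : (Fin n × Fin n) ⊕ (Fin n × Fin n) → Measure ℝ :=
    Sum.elim (fun _ => bernoulliMeasure (1 : ℝ) 0 p) (fun _ => μ)
  have hν : ∀ i, IsProbabilityMeasure (ν i) := by
    rintro (i | i)
    · exact inferInstanceAs (IsProbabilityMeasure (bernoulliMeasure (1 : ℝ) 0 p))
    · exact inferInstanceAs (IsProbabilityMeasure μ)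
  have hjoint : HasLaw (fun ω i => Sum.elim (fun ij : Fin n × Fin n => δ ij.1 ij.2)
      (fun ij : Fin n × Fin n => ξ ij.1 ij.2) i ω) (Measure.pi ν) P := by
    refine iIndepFun.hasLaw_pi ?_ h.indep
    rintro (i | i)
    · exact h.law_delta i.1 i.2
    · exact h.law_xi i.1 i.2
  let Ψ : ((Fin n × Fin n) ⊕ (Fin n × Fin n) → ℝ) → Fin n → Fin n → ℝ :=
    fun y i j => y (Sum.inl (i, j)) * y (Sum.inr (i, j))
  let Φ : (Fin n → Fin n → ℝ × ℝ) → (Fin n × Fin n) ⊕ (Fin n × Fin n) → ℝ :=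
    fun q => Sum.elim (fun ij => (q ij.1 ij.2).1) (fun ij => (q ij.1 ij.2).2)
  have hΨ : Measurable Ψ := by fun_prop
  have hΦ : Measurable Φ := by
    refine measurable_pi_lambda _ ?_
    rintro (i | i) <;> simp only [Φ, Sum.elim_inl, Sum.elim_inr] <;> fun_prop
  have hΦmap : (Measure.pi fun _ : Fin n => Measure.pi fun _ : Fin n =>
      (bernoulliMeasure (1 : ℝ) 0 p).prod μ).map Φ = Measure.pi ν := by
    refine (Measure.pi_eq fun s hs => ?_).symm
    have hpre : Φ ⁻¹' (Set.univ.pi s) = Set.univ.pi fun i => Set.univ.pi fun j =>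
        s (Sum.inl (i, j)) ×ˢ s (Sum.inr (i, j)) := by
      ext q
      simp only [Set.mem_preimage, Set.mem_univ_pi, Sum.forall, Set.mem_prod, Prod.forall, Φ,
        Sum.elim_inl, Sum.elim_inr]
      exact ⟨fun h i j => ⟨h.1 i j, h.2 i j⟩, fun h => ⟨fun i j => (h i j).1, fun i j => (h i j).2⟩⟩
    rw [Measure.map_apply hΦ (MeasurableSet.univ_pi hs), hpre, Measure.pi_pi]
    simp only [Measure.pi_pi, Measure.prod_prod, Fintype.prod_sum_type, Fintype.prod_prod_type,
      Finset.prod_mul_distrib, ν, Sum.elim_inl, Sum.elim_inr]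
  have hmul : MeasurePreserving (fun q : ℝ × ℝ => q.1 * q.2)
      ((bernoulliMeasure (1 : ℝ) 0 p).prod μ) (sparseEntryLaw p μ) := ⟨by fun_prop, rfl⟩
  have hpres := measurePreserving_pi (fun _ : Fin n => Measure.pi fun _ : Fin n =>
      (bernoulliMeasure (1 : ℝ) 0 p).prod μ) _
      fun _ => measurePreserving_pi (fun _ : Fin n => (bernoulliMeasure (1 : ℝ) 0 p).prod μ) _
        fun _ => hmul
  have hΨmap : MeasurePreserving Ψ (Measure.pi ν)
      (Measure.pi fun _ : Fin n => Measure.pi fun _ : Fin n => sparseEntryLaw p μ) := by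
    refine ⟨hΨ, ?_⟩
    rw [← hΦmap, Measure.map_map hΨ hΦ, ← hpres.map_eq]
    rfl
  exact hΨmap.fun_comp_hasLaw hjoint

/-- By Tonelli coordinate i can be integrated first; the remaining coordinates carry a probability
measure. -/
lemma lintegral_pi_le_of_forall_update {n : ℕ} {Y : Type*} [MeasurableSpace Y] [Nonempty Y]
    {κ : Measure Y} [IsProbabilityMeasure κ] {F : (Fin n → Y) → ℝ≥0∞} (hF : Measurable F)
    (i : Fin n) {C : ℝ≥0∞} (h : ∀ r, ∫⁻ s, F (Function.update r i s) ∂κ ≤ C) :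
    ∫⁻ r, F r ∂(Measure.pi fun _ => κ) ≤ C := by
  obtain ⟨y⟩ := ‹Nonempty Y›
  rw [lintegral_eq_lmarginal_univ (fun _ => y), lmarginal_erase' _ hF (Finset.mem_univ i)]
  refine (lmarginal_mono (g := fun _ => C) h _).trans ?_
  simp [lmarginal]

/-- The conjugates of the rows of `s r - z`. -/
def shiftedRow {n : ℕ} (s : ℝ) (z : ℂ) (r : Fin n → Fin n → ℝ) (k : Fin n) : Fin n → ℂ :=
  fun j => ((s * r k j : ℝ) : ℂ) - if j = k then star z else 0

variable {n : ℕ} {η : ℝ}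

lemma conjTranspose_scaledShift_mul_self (p : ℝ) (z : ℂ) (r : Fin n → Fin n → ℝ) :
    (scaledShift p (Matrix.of r) z)ᴴ * scaledShift p (Matrix.of r) z =
      ∑ k, vecMulVec (shiftedRow (1 / √(p * n)) z r k)
        (star (shiftedRow (1 / √(p * n)) z r k)) := by
  have h1 (k j : Fin n) : star (shiftedRow (1 / √(p * n)) z r k j) =
      scaledShift p (Matrix.of r) z k j := by
    rw [shiftedRow, scaledShift]
    by_cases h : j = k
    · subst h; simp
    · simp [h, Matrix.one_apply_ne (Ne.symm h)]
  ext a b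
  rw [mul_apply, Matrix.sum_apply]
  refine Finset.sum_congr rfl fun k _ => ?_
  rw [conjTranspose_apply, vecMulVec_apply, Pi.star_apply, ← h1, ← h1, star_star]

/-- Changing row i leaves the sum over the other rows fixed, so the row estimate applies
conditionally. The constant is 22 = 2(2 + 9). -/
lemma lintegral_normalizedTrace_le {κ : Measure ℝ} [IsProbabilityMeasure κ] (hη : 0 < η)
    (hn : 0 < n) (s : ℝ) (z : ℂ)
    (hrow : ∀ (i : Fin n) (H : Matrix (Fin n) (Fin n) ℂ), H.PosSemidef →
      ∫⁻ r : Fin n → ℝ, ENNReal.ofReal (max 0 (normalizedTrace η H - 1) /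
        (η + (star (fun j => ((s * r j : ℝ) : ℂ) - if j = i then star z else 0) ⬝ᵥ
          smoothedResolvent η H *ᵥ
            (fun j => ((s * r j : ℝ) : ℂ) - if j = i then star z else 0)).re))
        ∂(Measure.pi fun _ => κ) ≤ ENNReal.ofReal 9) :
    ∫⁻ r : Fin n → Fin n → ℝ, ENNReal.ofReal (2 * η * normalizedTrace η
      (∑ k, vecMulVec (shiftedRow s z r k) (star (shiftedRow s z r k))))
      ∂(Measure.pi fun _ => Measure.pi fun _ => κ) ≤ ENNReal.ofReal (22 * η) := by
  have hn' : (0 : ℝ) < n := by exact_mod_cast hn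
  have hp (t : Finset (Fin n)) (r : Fin n → Fin n → ℝ) :
      (∑ k ∈ t, vecMulVec (shiftedRow s z r k) (star (shiftedRow s z r k))).PosSemidef :=
    posSemidef_sum _ fun k _ => posSemidef_vecMulVec_self_star _
  have hcx (k : Fin n) : Continuous fun r : Fin n → Fin n → ℝ => shiftedRow s z r k := by
    unfold shiftedRow
    fun_prop
  have hcH (t : Finset (Fin n)) : Continuous fun r : Fin n → Fin n → ℝ =>
      smoothedResolvent η (∑ k ∈ t, vecMulVec (shiftedRow s z r k) (star (shiftedRow s z r k))) := by
    refine Continuous.smoothedResolvent hη ?_ (hp t)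
    exact continuous_finsetSum _ fun k _ => (hcx k).matrix_vecMulVec (hcx k).star
  let N (i : Fin n) (r : Fin n → Fin n → ℝ) : ℝ := max 0 (normalizedTrace η
    (∑ k ∈ Finset.univ.erase i, vecMulVec (shiftedRow s z r k) (star (shiftedRow s z r k))) - 1)
  let Q (i : Fin n) (r : Fin n → Fin n → ℝ) : ℝ := (star (shiftedRow s z r i) ⬝ᵥ
    smoothedResolvent η (∑ k ∈ Finset.univ.erase i,
      vecMulVec (shiftedRow s z r k) (star (shiftedRow s z r k))) *ᵥ shiftedRow s z r i).re
  have hQ0 (i : Fin n) (r) : 0 ≤ Q i r :=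
    (posSemidef_smoothedResolvent hη (hp _ r)).re_dotProduct_nonneg _
  have hcN (i : Fin n) : Continuous (N i) := by
    refine continuous_const.max (Continuous.sub ?_ continuous_const)
    exact (Complex.continuous_re.comp (hcH _).matrix_trace).div_const _
  have hcQ (i : Fin n) : Continuous (Q i) :=
    Complex.continuous_re.comp ((hcx i).star.dotProduct ((hcH _).matrix_mulVec (hcx i)))
  have hcF (i : Fin n) : Continuous fun r => N i r / (η + Q i r) :=
    (hcN i).div (continuous_const.add (hcQ i)) fun r => by have := hQ0 i r; positivity
  have hF0 (i : Fin n) (r) : 0 ≤ N i r / (η + Q i r) :=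
    div_nonneg (le_max_left _ _) (add_nonneg hη.le (hQ0 i r))
  have hF (i : Fin n) : ∫⁻ r, ENNReal.ofReal (N i r / (η + Q i r))
      ∂(Measure.pi fun _ => Measure.pi fun _ => κ) ≤ ENNReal.ofReal 9 := by
    refine lintegral_pi_le_of_forall_update (hcF i).measurable.ennreal_ofReal i fun r => ?_
    refine le_trans (le_of_eq ?_) (hrow i (∑ k ∈ Finset.univ.erase i,
      vecMulVec (shiftedRow s z r k) (star (shiftedRow s z r k))) (hp _ r))
    refine lintegral_congr fun y => ?_
    have h1 : ∑ k ∈ Finset.univ.erase i, vecMulVec (shiftedRow s z (Function.update r i y) k)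
        (star (shiftedRow s z (Function.update r i y) k)) =
        ∑ k ∈ Finset.univ.erase i, vecMulVec (shiftedRow s z r k) (star (shiftedRow s z r k)) := by
      refine Finset.sum_congr rfl fun k hk => ?_
      unfold shiftedRow
      rw [Function.update_of_ne (Finset.ne_of_mem_erase hk)]
    have h2 : shiftedRow s z (Function.update r i y) i =
        fun j => ((s * y j : ℝ) : ℂ) - if j = i then star z else 0 := by
      unfold shiftedRow
      rw [Function.update_self]
    simp only [N, Q, h1, h2]
  calc _ ≤ ∫⁻ r : Fin n → Fin n → ℝ, (ENNReal.ofReal (4 * η) + ENNReal.ofReal (2 * η * (n : ℝ)⁻¹) *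
        ∑ i, ENNReal.ofReal (N i r / (η + Q i r)))
        ∂(Measure.pi fun _ => Measure.pi fun _ => κ) := by
        refine lintegral_mono fun r => ?_
        rw [← ENNReal.ofReal_sum_of_nonneg fun i _ => hF0 i r, ← ENNReal.ofReal_mul (by positivity),
          ← ENNReal.ofReal_add (by positivity)
            (mul_nonneg (by positivity) (Finset.sum_nonneg fun i _ => hF0 i r))]
        apply ENNReal.ofReal_le_ofReal
        have := mul_le_mul_of_nonneg_left
          (normalizedTrace_le_add_average hη hn (shiftedRow s z r)) (by positivity : 0 ≤ 2 * η)
        refine this.trans (le_of_eq ?_)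
        simp only [N, Q]
        ring
    _ = ENNReal.ofReal (4 * η) + ENNReal.ofReal (2 * η * (n : ℝ)⁻¹) *
        ∑ i, ∫⁻ r, ENNReal.ofReal (N i r / (η + Q i r))
          ∂(Measure.pi fun _ => Measure.pi fun _ => κ) := by
        rw [lintegral_add_left measurable_const, lintegral_const, measure_univ, mul_one,
          lintegral_const_mul _
            (Finset.measurable_sum _ fun i _ => (hcF i).measurable.ennreal_ofReal),
          lintegral_finsetSum _ fun i _ => (hcF i).measurable.ennreal_ofReal]
    _ ≤ ENNReal.ofReal (4 * η) + ENNReal.ofReal (2 * η * (n : ℝ)⁻¹) *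
        ∑ _i : Fin n, ENNReal.ofReal 9 := by
        gcongr with i
        exact hF i
    _ = _ := by
        rw [← ENNReal.ofReal_sum_of_nonneg fun i _ => by norm_num,
          ← ENNReal.ofReal_mul (by positivity), ← ENNReal.ofReal_add (by positivity) (by simp; positivity)]
        congr 1
        simp
        field_simp
        ring

lemma measurable_normalizedTrace_shiftedRow (hη : 0 < η) (s : ℝ) (z : ℂ) :
    Measurable fun r : Fin n → Fin n → ℝ => normalizedTrace η
      (∑ k, vecMulVec (shiftedRow s z r k) (star (shiftedRow s z r k))) := by
  have hcx (k : Fin n) : Continuous fun r : Fin n → Fin n → ℝ => shiftedRow s z r k := by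
    unfold shiftedRow
    fun_prop
  have hc := Continuous.smoothedResolvent hη
    (continuous_finsetSum Finset.univ fun k _ => (hcx k).matrix_vecMulVec (hcx k).star)
    fun r => posSemidef_sum _ fun k _ => posSemidef_vecMulVec_self_star _
  exact ((Complex.continuous_re.comp hc.matrix_trace).div_const _).measurable

lemma expectedSmallMass_le_lintegral_normalizedTrace {Ω : Type*} [MeasurableSpace Ω]
    {P : Measure Ω} {p : I} {μ : Measure ℝ} [IsProbabilityMeasure μ]
    {δ ξ : Fin n → Fin n → Ω → ℝ} (h : IsSparseModel P p μ δ ξ) (hη : 0 < η) (hn : 0 < n)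
    (z : ℂ) :
    expectedSmallMass P p δ ξ z η ≤
      ∫⁻ r : Fin n → Fin n → ℝ, ENNReal.ofReal (2 * η * normalizedTrace η
        (∑ k, vecMulVec (shiftedRow (1 / √(p * n)) z r k)
          (star (shiftedRow (1 / √(p * n)) z r k))))
        ∂(Measure.pi fun _ => Measure.pi fun _ => sparseEntryLaw p μ) := by
  rw [← h.hasLaw_entries.lintegral_comp (((measurable_normalizedTrace_shiftedRow hη _
    z).const_mul _).ennreal_ofReal).aemeasurable]
  refine lintegral_mono fun ω => ?_
  have := empiricalSingularMeasure_Icc_le hη hn (scaledShift (p : ℝ) (sparseMatrix δ ξ ω) z)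
  rwa [sparseMatrix, conjTranspose_scaledShift_mul_self] at this

end model

/-! ### Truncation and the moments of a sparse entry. -/

section moments

open Matrix
open scoped ComplexOrder

/-- The truncation of `x` at level `M`. -/
noncomputable def cutoff (M x : ℝ) : ℝ := if |x| ≤ M then x else 0

lemma measurable_cutoff (M : ℝ) : Measurable (cutoff M) := by
  unfold cutoff
  exact Measurable.ite (measurableSet_le (by fun_prop) measurable_const) measurable_id
    measurable_const

lemma cutoff_zero (M : ℝ) : cutoff M 0 = 0 := by simp [cutoff]

lemma abs_cutoff_le {M : ℝ} (hM : 0 ≤ M) (x : ℝ) : |cutoff M x| ≤ M := by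
  unfold cutoff; split_ifs with h <;> simp [h, hM]

lemma abs_cutoff_le_abs (M x : ℝ) : |cutoff M x| ≤ |x| := by
  unfold cutoff; split_ifs with h <;> simp

lemma mul_cutoff (M x : ℝ) : x * cutoff M x = cutoff M x ^ 2 := by
  unfold cutoff; split_ifs with h
  · ring
  · simp

/-- The expression inside the square is x below the truncation level and 2x above it. -/
lemma sq_two_mul_sub_cutoff_le (M x : ℝ) : (2 * x - cutoff M x) ^ 2 ≤ 4 * x ^ 2 := by
  unfold cutoff; split_ifs with h <;> nlinarith [sq_nonneg x]

variable {μ : Measure ℝ}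

lemma memLp_cutoff (hμ : MemLp (fun x : ℝ => x) 2 μ) (M : ℝ) : MemLp (cutoff M) 2 μ :=
  hμ.of_le (measurable_cutoff M).aestronglyMeasurable
    (Eventually.of_forall fun x => abs_cutoff_le_abs M x)

/-- Dominated convergence as the level grows. The level M depends on the whole law, which is how the
law enters the threshold for η. -/
lemma exists_half_le_integral_sq_cutoff (hμ : MemLp (fun x : ℝ => x) 2 μ)
    (h1 : 1 ≤ ∫ x, x ^ 2 ∂μ) : ∃ M : ℝ, 0 ≤ M ∧ 1 / 2 ≤ ∫ x, cutoff M x ^ 2 ∂μ := by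
  have ht : Tendsto (fun N : ℕ => ∫ x, cutoff N x ^ 2 ∂μ) atTop (nhds (∫ x, x ^ 2 ∂μ)) := by
    refine tendsto_integral_of_dominated_convergence (fun x => x ^ 2)
      (fun N => ((measurable_cutoff N).pow_const 2).aestronglyMeasurable) hμ.integrable_sq
      (fun N => Eventually.of_forall fun x => ?_) (Eventually.of_forall fun x => ?_)
    · rw [Real.norm_of_nonneg (sq_nonneg _), sq_le_sq]
      exact abs_cutoff_le_abs _ _
    · refine tendsto_const_nhds.congr' ?_
      filter_upwards [eventually_ge_atTop ⌈|x|⌉₊] with N hN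
      rw [cutoff, if_pos (Nat.ceil_le.1 hN)]
  obtain ⟨N, hN⟩ := (ht.eventually (lt_mem_nhds (by linarith : 1 / 2 < ∫ x, x ^ 2 ∂μ))).exists
  exact ⟨N, Nat.cast_nonneg N, hN.le⟩

variable [IsProbabilityMeasure μ]

lemma memLp_sparseEntryLaw (p : I) {h : ℝ → ℝ} (hm : Measurable h) (hh : MemLp h 2 μ) :
    MemLp h 2 (sparseEntryLaw p μ) :=
  (memLp_two_iff_integrable_sq hm.aestronglyMeasurable).2
    (integrable_sparseEntryLaw p hh.integrable_sq)

lemma integral_sq_const_mul_sub_mean_le {κ : Measure ℝ} [IsProbabilityMeasure κ] {h : ℝ → ℝ}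
    (hm : Measurable h) (s : ℝ) :
    ∫ x, (s * (h x - ∫ y, h y ∂κ)) ^ 2 ∂κ ≤ s ^ 2 * ∫ x, h x ^ 2 ∂κ := by
  simp only [mul_pow]
  rw [integral_const_mul, ← variance_eq_integral hm.aemeasurable]
  gcongr
  exact variance_le_expectation_sq hm.aestronglyMeasurable

lemma integral_const_mul_sub_mean {κ : Measure ℝ} [IsProbabilityMeasure κ] {h : ℝ → ℝ}
    (hi : Integrable h κ) (s : ℝ) : ∫ x, s * (h x - ∫ y, h y ∂κ) ∂κ = 0 := by
  rw [integral_const_mul, integral_sub hi (integrable_const _)]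
  simp

/-- The quadratic form of a random row of the sparse model dominates the normalised trace. -/
lemma lintegral_sparse_row_le {θ M : ℝ} {z : ℂ} {n : ℕ} {p : I} {η : ℝ}
    (hμ : MemLp (fun x : ℝ => x) 2 μ) (hθ : ∫ x, x ∂μ = θ) (hM : 0 ≤ M)
    (hw : 1 / 2 ≤ ∫ x, cutoff M x ^ 2 ∂μ) (hn : 0 < n) (hp : 0 < (p : ℝ))
    (hpθ : p * θ ^ 2 ≤ 1 / 4) (hη : 0 < η)
    (hlarge : 256 * (16 * M ^ 2 * (∫ x, x ^ 2 ∂μ) + 4 * (∫ x, x ^ 2 ∂μ) ^ 2 +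
      (∫ x, x ^ 2 ∂μ) * (8 * θ ^ 2 + 8 * ‖z‖ ^ 2)) ≤ η ^ 3 * (p * n))
    (i : Fin n) {H : Matrix (Fin n) (Fin n) ℂ} (hH : H.PosSemidef) :
    ∫⁻ r : Fin n → ℝ, ENNReal.ofReal (max 0 (normalizedTrace η H - 1) /
      (η + (star (fun j => ((1 / √(p * n) * r j : ℝ) : ℂ) - if j = i then star z else 0) ⬝ᵥ
        smoothedResolvent η H *ᵥ
          (fun j => ((1 / √(p * n) * r j : ℝ) : ℂ) - if j = i then star z else 0)).re))
      ∂(Measure.pi fun _ => sparseEntryLaw p μ) ≤ ENNReal.ofReal 9 := by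
  have hn' : (0 : ℝ) < n := by exact_mod_cast hn
  have hp1 : (p : ℝ) ≤ 1 := p.2.2
  set s : ℝ := 1 / √(p * n) with hs
  have hs0 : 0 ≤ s := by positivity
  have hd : (0 : ℝ) < p * n := by positivity
  have hs2 : s ^ 2 = 1 / (p * n) := by
    rw [hs, div_pow, Real.sq_sqrt hd.le, one_pow]
  have hs2p : s ^ 2 * p = 1 / n := by rw [hs2]; field_simp
  set κ := sparseEntryLaw p μ with hκ
  set K := ∫ x, x ^ 2 ∂μ with hK
  have hK0 : 0 ≤ K := integral_nonneg fun _ => sq_nonneg _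
  -- This is the factor 2x - u for u the truncation of x, chosen because its product with the
  -- truncation is exactly the truncation squared.
  let A : ℝ → ℝ := fun x => 2 * x - cutoff M x
  have hcm : Measurable (cutoff M) := measurable_cutoff M
  have hAm : Measurable A := by fun_prop
  have hcμ : MemLp (cutoff M) 2 μ := memLp_cutoff hμ M
  have hAμ : MemLp A 2 μ := (hμ.const_mul 2).sub hcμ
  have hcκ : MemLp (cutoff M) 2 κ := memLp_sparseEntryLaw p hcm hcμ
  have hAκ : MemLp A 2 κ := memLp_sparseEntryLaw p hAm hAμ
  have hA0 : A 0 = 0 := by simp [A, cutoff_zero]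
  set τ := ∫ x, cutoff M x ∂μ with hτ
  set Ec := ∫ x, cutoff M x ∂κ with hEc
  set EA := ∫ x, A x ∂κ with hEA
  have hEc' : Ec = p * τ := integral_sparseEntryLaw p (hcμ.integrable one_le_two) (cutoff_zero M)
  have hEA' : EA = p * (2 * θ - τ) := by
    rw [hEA, hκ, integral_sparseEntryLaw p (hAμ.integrable one_le_two) hA0,
      integral_sub ((hμ.integrable one_le_two).const_mul 2) (hcμ.integrable one_le_two),
      integral_const_mul, hθ]
  let f : ℝ → ℝ := fun x => s * (A x - EA)
  let g : ℝ → ℝ := fun x => s * (cutoff M x - Ec)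
  have hfm : Measurable f := by fun_prop
  have hgm : Measurable g := by fun_prop
  have hf2 : MemLp f 2 κ := (hAκ.sub (memLp_const EA)).const_mul s
  have hg2 : MemLp g 2 κ := (hcκ.sub (memLp_const Ec)).const_mul s
  have hgb (x : ℝ) : |g x| ≤ s * (2 * M) := by
    have h1 : |Ec| ≤ M := by
      have := norm_integral_le_of_norm_le_const (μ := κ) (f := cutoff M)
        (Eventually.of_forall fun x => abs_cutoff_le hM x)
      simpa using this
    rw [abs_mul, abs_of_nonneg hs0]
    gcongr
    refine (abs_sub _ _).trans ?_
    linarith [abs_cutoff_le hM x]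
  have hfgb (x : ℝ) : |f x * g x| ≤ s * (2 * M) * |f x| := by
    rw [abs_mul, mul_comm]
    gcongr
    exact hgb x
  have hfg2 : MemLp (fun x => f x * g x) 2 κ :=
    hf2.of_le_mul (by fun_prop) (Eventually.of_forall hfgb)
  have hA2 : ∫ x, f x ^ 2 ∂κ ≤ 4 * K / n := by
    refine (integral_sq_const_mul_sub_mean_le hAm s).trans ?_
    rw [hκ, integral_sparseEntryLaw p hAμ.integrable_sq (by simp [hA0]), ← mul_assoc, hs2p]
    have : ∫ x, A x ^ 2 ∂μ ≤ 4 * K := by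
      rw [hK, ← integral_const_mul]
      exact integral_mono hAμ.integrable_sq (hμ.integrable_sq.const_mul 4)
        fun x => sq_two_mul_sub_cutoff_le M x
    calc 1 / n * ∫ x, A x ^ 2 ∂μ ≤ 1 / n * (4 * K) := by gcongr
      _ = _ := by ring
  have hB2 : ∫ x, g x ^ 2 ∂κ ≤ K / n := by
    refine (integral_sq_const_mul_sub_mean_le hcm s).trans ?_
    rw [hκ, integral_sparseEntryLaw p hcμ.integrable_sq (by simp [cutoff_zero]), ← mul_assoc, hs2p]
    have : ∫ x, cutoff M x ^ 2 ∂μ ≤ K :=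
      integral_mono hcμ.integrable_sq hμ.integrable_sq
        fun x => sq_le_sq.2 (abs_cutoff_le_abs M x)
    calc 1 / n * ∫ x, cutoff M x ^ 2 ∂μ ≤ 1 / n * K := by gcongr
      _ = _ := by ring
  -- Here truncation is indispensable: boundedness of g reduces a fourth-order moment to the second
  -- moment of f.
  have hD2 : ∫ x, (f x * g x) ^ 2 ∂κ ≤ 16 * M ^ 2 * K / (p * n * n) := by
    calc _ ≤ ∫ x, (s * (2 * M)) ^ 2 * f x ^ 2 ∂κ := by
          refine integral_mono hfg2.integrable_sq (hf2.integrable_sq.const_mul _) fun x => ?_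
          simp only
          rw [← mul_pow, sq_le_sq]
          refine (hfgb x).trans (le_of_eq ?_)
          rw [abs_mul (s * (2 * M)), abs_of_nonneg (by positivity : 0 ≤ s * (2 * M))]
      _ ≤ (s * (2 * M)) ^ 2 * (4 * K / n) := by
          rw [integral_const_mul]; gcongr
      _ = _ := by
          rw [mul_pow, hs2]; field_simp; ring
  -- With τ the truncated mean under μ, the covariance is (1/n)(E[cutoff²] - p(2θ - τ)τ). Since (2θ
  -- - τ)τ ≤ θ², the bracket is at least 1/2 - 1/4.
  have hc : 1 / (4 * n) ≤ ∫ x, f x * g x ∂κ := by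
    have hAcμ : Integrable (fun x => A x * cutoff M x) μ := hAμ.integrable_mul hcμ
    have hAcκ : Integrable (fun x => A x * cutoff M x) κ := hAκ.integrable_mul hcκ
    have h1 : ∫ x, f x * g x ∂κ = s ^ 2 * (∫ x, A x * cutoff M x ∂κ - EA * Ec) := by
      have e (x : ℝ) : f x * g x =
          s ^ 2 * (A x * cutoff M x - EA * cutoff M x - Ec * A x + EA * Ec) := by
        simp only [f, g]; ring
      simp only [e]
      have i1 := (hcκ.integrable one_le_two).const_mul EA
      have i2 := (hAκ.integrable one_le_two).const_mul Ec
      have i3 : Integrable (fun x => A x * cutoff M x - EA * cutoff M x) κ := hAcκ.sub i1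
      have i4 : Integrable (fun x => A x * cutoff M x - EA * cutoff M x - Ec * A x) κ := i3.sub i2
      rw [integral_const_mul, integral_add i4 (integrable_const _), integral_sub i3 i2, integral_sub hAcκ i1, integral_const_mul,
        integral_const_mul, ← hEc, ← hEA]
      simp only [integral_const, probReal_univ, one_smul]
      ring
    have h2 : ∫ x, A x * cutoff M x ∂κ = p * ∫ x, cutoff M x ^ 2 ∂μ := by
      rw [hκ, integral_sparseEntryLaw p hAcμ (by simp [hA0])]
      congr 2
      ext x
      have := mul_cutoff M x
      simp only [A]
      linarith
    rw [h1, h2, hEA', hEc']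
    have h3 : s ^ 2 * (p * ∫ x, cutoff M x ^ 2 ∂μ - p * (2 * θ - τ) * (p * τ)) =
        s ^ 2 * p * (∫ x, cutoff M x ^ 2 ∂μ - p * ((2 * θ - τ) * τ)) := by ring
    rw [h3, hs2p]
    have h4 : (p : ℝ) * ((2 * θ - τ) * τ) ≤ p * θ ^ 2 := by
      gcongr
      nlinarith [sq_nonneg (θ - τ)]
    calc 1 / (4 * (n : ℝ)) = 1 / n * (1 / 4) := by ring
      _ ≤ _ := by gcongr; linarith
  have hw : ∑ j : Fin n, ‖(if j = i then star z else 0 : ℂ)‖ ^ 2 = ‖z‖ ^ 2 := by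
    rw [Finset.sum_eq_single i] <;> simp +contextual
  refine lintegral_trace_div_quadraticForm_le (a := fun x => s * x) (b := s * (2 * p * θ)) hfm hgm
    hf2 hg2 hfg2 (integral_const_mul_sub_mean (hAκ.integrable one_le_two) s)
    (integral_const_mul_sub_mean (hcκ.integrable one_le_two) s) (fun x => ?_)
    (fun j => if j = i then star z else 0) hη hH hn hc ?_
  · have : EA + Ec = 2 * p * θ := by rw [hEA', hEc']; ring
    simp only [f, g, A, ← this]
    ring
  · rw [hw]
    have hb : 2 * (n : ℝ) * (s * (2 * p * θ)) ^ 2 = 8 * p * θ ^ 2 := by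
      rw [mul_pow, hs2]; field_simp; ring
    rw [hb]
    have i2 : 0 ≤ ∫ x, f x ^ 2 ∂κ := integral_nonneg fun _ => sq_nonneg _
    have i3 : 0 ≤ ∫ x, g x ^ 2 ∂κ := integral_nonneg fun _ => sq_nonneg _
    -- All terms scale as 1/(pn η²) after p ≤ 1 is used; the constant 256 = 4 · 64 in `hlarge` is
    -- what brings the result down to η/64.
    calc _ ≤ 4 * ((16 * M ^ 2 * K / (p * n * n) + 4 * K / n * (K / n)) * (n / η ^ 2) +
          K / n * ((8 * p * θ ^ 2 + 8 * ‖z‖ ^ 2) / η ^ 2)) := by gcongr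
      _ = 4 / (p * n * η ^ 2) * (16 * M ^ 2 * K + 4 * p * K ^ 2 +
          p * K * (8 * p * θ ^ 2 + 8 * ‖z‖ ^ 2)) := by field_simp
      _ ≤ 4 / (p * n * η ^ 2) * (16 * M ^ 2 * K + 4 * 1 * K ^ 2 +
          1 * K * (8 * 1 * θ ^ 2 + 8 * ‖z‖ ^ 2)) := by gcongr
      _ ≤ 4 / (p * n * η ^ 2) * (η ^ 3 * (p * n) / 256) := by gcongr; linarith
      _ = η / 64 := by field_simp; norm_num

lemma expectedSmallMass_le {θ M : ℝ} {z : ℂ} {n : ℕ} {p : I} {η : ℝ} {Ω : Type*}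
    [MeasurableSpace Ω] {P : Measure Ω} {δ ξ : Fin n → Fin n → Ω → ℝ}
    (hmodel : IsSparseModel P p μ δ ξ)
    (hμ : MemLp (fun x : ℝ => x) 2 μ) (hθ : ∫ x, x ∂μ = θ) (hM : 0 ≤ M)
    (hw : 1 / 2 ≤ ∫ x, cutoff M x ^ 2 ∂μ) (hn : 0 < n) (hp : 0 < (p : ℝ))
    (hpθ : p * θ ^ 2 ≤ 1 / 4) (hη : 0 < η)
    (hlarge : 256 * (16 * M ^ 2 * (∫ x, x ^ 2 ∂μ) + 4 * (∫ x, x ^ 2 ∂μ) ^ 2 +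
      (∫ x, x ^ 2 ∂μ) * (8 * θ ^ 2 + 8 * ‖z‖ ^ 2)) ≤ η ^ 3 * (p * n)) :
    expectedSmallMass P p δ ξ z η ≤ ENNReal.ofReal (22 * η) :=
  (expectedSmallMass_le_lintegral_normalizedTrace hmodel hη hn z).trans
    (lintegral_normalizedTrace_le hη hn _ z fun i _ hH =>
      lintegral_sparse_row_le hμ hθ hM hw hn hp hpθ hη hlarge i hH)

lemma expectedSmallMass_le_one {z : ℂ} {n : ℕ} {p η : ℝ} {Ω : Type*} [MeasurableSpace Ω]
    {P : Measure Ω} [IsProbabilityMeasure P] {δ ξ : Fin n → Fin n → Ω → ℝ} (hn : 0 < n) :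
    expectedSmallMass P p δ ξ z η ≤ 1 := by
  refine (lintegral_mono fun ω => empiricalSingularMeasure_le_one hn _ _).trans ?_
  simp

end moments

/-! ### Choice of the constants. -/

theorem lemma9p8 :
    ∃ c : ℝ, 0 < c ∧
    ∀ (θ : ℝ) (z : ℂ), z.im ≠ 0 →
    ∃ C : ℝ, 0 < C ∧
    -- the law `μ` of `ξ`
    ∀ (μ : Measure ℝ) [IsProbabilityMeasure μ],
      MemLp (fun x : ℝ => x) 2 μ → ∫ x, x ∂μ = θ → Var[fun x : ℝ => x; μ] = 1 →
    ∃ C' η₀ : ℝ, 0 < C' ∧ 0 < η₀ ∧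
    ∀ (p : ℕ → I),
      (∀ n : ℕ, 1 ≤ n → (p n : ℝ) * n ≤ (n : ℝ) ^ (1 / 8 : ℝ)) →
      Tendsto (fun n : ℕ => (p n : ℝ) * n) atTop atTop →
    ∀ (Ω : ℕ → Type*) [∀ n, MeasurableSpace (Ω n)]
      (P : ∀ n, Measure (Ω n)) [∀ n, IsProbabilityMeasure (P n)]
      (δ ξ : ∀ n, Fin n → Fin n → Ω n → ℝ),
      (∀ n : ℕ, 1 ≤ n → IsSparseModel (P n) (p n) μ (δ n) (ξ n)) →
    ∀ n : ℕ, 1 ≤ n → 0 < (p n : ℝ) →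
    ∀ η : ℝ, ((p n : ℝ) * n) ^ (-c) ≤ η →
      expectedSmallMass (P n) (p n : ℝ) (δ n) (ξ n) z η ≤ ENNReal.ofReal (C' * η) ∧
      (η ≤ η₀ →
        expectedSmallMass (P n) (p n : ℝ) (δ n) (ξ n) z η ≤ ENNReal.ofReal (C * η)) := by
  -- With d = pn and exponent 1/6, η³d ≥ √d, so the largeness condition becomes K ≤ √d.
  refine ⟨1 / 6, by norm_num, fun θ z _ => ⟨22, by norm_num, fun μ _ hμ hθ hvar => ?_⟩⟩
  have hsq : 1 ≤ ∫ x, x ^ 2 ∂μ := by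
    rw [variance_eq_sub hμ, hθ] at hvar
    have : ∫ x, x ^ 2 ∂μ = 1 + θ ^ 2 := by
      rw [← hvar]; simp
    nlinarith [sq_nonneg θ]
  obtain ⟨M, hM, hw⟩ := exists_half_le_integral_sq_cutoff hμ hsq
  set K := 256 * (16 * M ^ 2 * (∫ x, x ^ 2 ∂μ) + 4 * (∫ x, x ^ 2 ∂μ) ^ 2 +
      (∫ x, x ^ 2 ∂μ) * (8 * θ ^ 2 + 8 * ‖z‖ ^ 2)) with hK
  have hK0 : 0 ≤ K := by positivity
  -- For d ≥ D the term K² yields K ≤ √d, and 4θ² yields pθ² ≤ 1/4.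
  set D : ℝ := 1 + 4 * θ ^ 2 + K ^ 2 with hD
  have hD0 : 0 < D := by positivity
  have hDc : 0 < D ^ (1 / 6 : ℝ) := Real.rpow_pos_of_pos hD0 _
  have hDc' : 0 < D ^ (-(1 / 6) : ℝ) := Real.rpow_pos_of_pos hD0 _
  refine ⟨max 22 (D ^ (1 / 6 : ℝ)), D ^ (-(1 / 6) : ℝ) / 2, by positivity, by positivity, ?_⟩
  intro p hpn _ Ω _ P _ δ ξ hmodel n hn hp η hη
  have hn' : (1 : ℝ) ≤ n := by exact_mod_cast hn
  set d : ℝ := p n * n with hd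
  have hd0 : 0 < d := by positivity
  have hη0 : 0 < η := (Real.rpow_pos_of_pos hd0 _).trans_le hη
  rcases le_or_gt D d with hDd | hDd
  · have hd1 : 1 ≤ d := by nlinarith [sq_nonneg θ, sq_nonneg K]
    have hdd : d * d ≤ n := by
      have h1 : d ≤ (n : ℝ) ^ (1 / 2 : ℝ) :=
        (hpn n hn).trans (Real.rpow_le_rpow_of_exponent_le hn' (by norm_num))
      rw [← Real.sqrt_eq_rpow] at h1
      calc d * d ≤ √n * √n := by gcongr
        _ = n := Real.mul_self_sqrt (by positivity)
    -- The growth bound on pn gives d² ≤ n, hence p ≤ 1/d: sparsity makes the squared mean of an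
    -- entry negligible against its second moment.
    have hpd : (p n : ℝ) * d ≤ 1 := by
      have : (p n : ℝ) * d * n ≤ 1 * n := by
        rw [one_mul]; refine le_trans (le_of_eq ?_) hdd; rw [hd]; ring
      exact le_of_mul_le_mul_right this (by positivity)
    have hpθ : (p n : ℝ) * θ ^ 2 ≤ 1 / 4 := by
      have : 4 * θ ^ 2 ≤ d := by nlinarith [sq_nonneg K]
      nlinarith [mul_le_mul_of_nonneg_left this hp.le]
    have hlarge : K ≤ η ^ 3 * d := by
      have h1 : K ≤ √d := Real.le_sqrt_of_sq_le (by nlinarith [sq_nonneg θ])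
      have h2 : (d ^ (-(1 / 6) : ℝ)) ^ 3 * d = √d := by
        rw [← Real.rpow_natCast, ← Real.rpow_mul hd0.le, ← Real.rpow_add_one hd0.ne',
          Real.sqrt_eq_rpow]
        norm_num
      rw [← h2] at h1
      refine h1.trans ?_
      have := (Real.rpow_pos_of_pos hd0 (-(1 / 6) : ℝ)).le
      gcongr
    have hmain := expectedSmallMass_le (hmodel n hn) hμ hθ hM hw hn hp hpθ hη0 hlarge
    refine ⟨hmain.trans (ENNReal.ofReal_le_ofReal ?_), fun _ => hmain⟩
    gcongr
    exact le_max_left _ _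
  -- For d < D every admissible η is at least D^(-1/6). So C'η ≥ 1, and the factor 1/2 in η₀ leaves
  -- no admissible η ≤ η₀, keeping C free of the law of ξ.
  · have hηD : D ^ (-(1 / 6) : ℝ) ≤ η :=
      (Real.rpow_le_rpow_of_nonpos hd0 hDd.le (by norm_num)).trans hη
    refine ⟨(expectedSmallMass_le_one hn).trans ?_, fun h => by linarith⟩
    rw [ENNReal.one_le_ofReal]
    calc (1 : ℝ) = D ^ (1 / 6 : ℝ) * D ^ (-(1 / 6) : ℝ) := by
          rw [← Real.rpow_add hD0]; norm_num
      _ ≤ _ := by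
          gcongr
          exact le_max_right _ _
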